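/- **Proposition 4.10.** Let $F$ be a tropical fan of dimension $2$ in $\mathbb R^n$: a fan of rational strongly convex cones of pure dimension $2$ with weights $\omega(\sigma)\in\mathbb Z_{\ge 0}$ on its facets (its $2$-dimensional cones), satisfying the balancing condition at every ray. Let $L_1=\max(l_1,h_1)$ and $L_2=\max(l_2,h_2)$ be tropical binomials, where $l_i,h_i$ are linear functionals on $\mathbb R^n$ with integer coefficients, such that the tropical intersection product satisfies $L_1\cdot L_2\cdot[F]=1$. Let $$g(F,L_1,L_2)=\{\sigma\in F^{(2)} \mid \dim\big((V(L_1)\cap V(L_2))+\langle\sigma\rangle\big)=n\},\qquad V(L_i)=\{x\in\mathbb R^n\mid l_i(x)=h_i(x)\},$$ be the gallery of $F$ over $L_1,L_2$. Suppose that it is non-empty and that none of its facets has weight $0$ (as is the case when all weights of $F$ are positive). Then for every ray ($1$-dimensional cone) $\rho$ of $F$ contained in the support $\bigcup_{\sigma\in g(F,L_1,L_2)}\sigma$ of the gallery, exactly two facets of the gallery contain $\rho$. Consequently the gallery forms a cycle: the graph whose vertices are the facets in $g(F,L_1,L_2)$, two different facets being adjacent when they have a ray of $F$ in common, is connected and each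 of its vertices has exactly two neighbours. -/

import Mathlib

namespace TropicalGallery

/-! ### Rational cones and fans in `ℝⁿ`, with lattice `ℤⁿ` -/

/-- Convex cones (containing `0`) in `ℝⁿ`. -/
abbrev Cone (n : ℕ) : Type := PointedCone ℝ (Fin n → ℝ)

/-- The inclusion of the lattice `ℤⁿ` into `ℝⁿ`. -/
def latticePt {n : ℕ} (z : Fin n → ℤ) : Fin n → ℝ := fun i => (z i : ℝ)

/-- `σ` is a convex polyhedral rational cone: it is generated by finitely many lattice vectors. -/
def IsRational {n : ℕ} (σ : Cone n) : Prop :=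
  ∃ S : Finset (Fin n → ℤ), σ = PointedCone.hull ℝ (latticePt '' (S : Set (Fin n → ℤ)))

/-- `σ` is strongly convex: `σ ∩ (-σ) = {0}`. -/
def IsStronglyConvex {n : ℕ} (σ : Cone n) : Prop := (σ : ConvexCone ℝ (Fin n → ℝ)).Salient

/-- The linear span `⟨σ⟩` of a cone. -/
def linSpan {n : ℕ} (σ : Cone n) : Submodule ℝ (Fin n → ℝ) :=
  Submodule.span ℝ (σ : Set (Fin n → ℝ))

/-- The dimension of a cone. -/
noncomputable def dim {n : ℕ} (σ : Cone n) : ℕ := Module.finrank ℝ (linSpan σ)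

/-- A (nonempty) fan of rational strongly convex cones in `ℝⁿ`. -/
structure Fan (n : ℕ) where
  cones : Finset (Cone n)
  nonempty : cones.Nonempty
  rational : ∀ σ ∈ cones, IsRational σ
  stronglyConvex : ∀ σ ∈ cones, IsStronglyConvex σ
  face_mem : ∀ σ ∈ cones, ∀ τ : Cone n, τ.IsFaceOf σ → τ ∈ cones
  inter_face : ∀ σ₁ ∈ cones, ∀ σ₂ ∈ cones, (σ₁ ⊓ σ₂).IsFaceOf σ₁ ∧ (σ₁ ⊓ σ₂).IsFaceOf σ₂

/-- The set `X^(d)` of `d`-dimensional cones of a fan. -/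
noncomputable def Fan.conesOfDim {n : ℕ} (X : Fan n) (d : ℕ) : Finset (Cone n) :=
  open Classical in X.cones.filter (fun σ => dim σ = d)

/-- The `d`-dimensional cones of `X` that contain the cone `τ`. For `dim τ = d - 1` these are
the `d`-dimensional cones `σ` with `τ < σ`, i.e. having `τ` as a proper face. -/
noncomputable def Fan.above {n : ℕ} (X : Fan n) (d : ℕ) (τ : Cone n) : Finset (Cone n) :=
  open Classical in (X.conesOfDim d).filter (fun σ => τ ≤ σ)

/-- `v` is a primitive generator `v_{σ/τ}` from `τ` to `σ`: a lattice vector of `σ` whose class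
generates the lattice `(ℤⁿ ∩ ⟨σ⟩) / (ℤⁿ ∩ ⟨τ⟩)`. -/
def IsPrimitiveGenerator {n : ℕ} (τ σ : Cone n) (v : Fin n → ℤ) : Prop :=
  latticePt v ∈ σ ∧
    ∀ w : Fin n → ℤ, latticePt w ∈ linSpan σ →
      ∃ m : ℤ, latticePt (w - m • v) ∈ linSpan τ

/-- A choice of primitive generators `v τ σ`, for all cones `τ < σ` of `X` with
`dim σ = d` and `dim τ = d - 1`. -/
def IsNormalSystem {n : ℕ} (X : Fan n) (d : ℕ) (v : Cone n → Cone n → Fin n → ℤ) : Prop :=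
  ∀ τ ∈ X.cones, dim τ + 1 = d → ∀ σ ∈ X.above d τ, IsPrimitiveGenerator τ σ (v τ σ)

/-- The balancing condition in dimension `k` for the weights `ω` of the `k`-dimensional cones.
Different choices of the primitive generator `v_{σ/τ}` differ by elements of `⟨τ⟩`, so the
condition does not depend on the choice. -/
def IsBalanced {n : ℕ} (X : Fan n) (k : ℕ) (ω : Cone n → ℕ) : Prop :=
  ∃ v : Cone n → Cone n → Fin n → ℤ, IsNormalSystem X k v ∧
    ∀ τ ∈ X.cones, dim τ + 1 = k →
      ∑ σ ∈ X.above k τ, (ω σ : ℝ) • latticePt (v τ σ) ∈ linSpan τ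

/-- A tropical fan of dimension `k` in `ℝⁿ`: a fan of pure dimension `k` with non-negative
integer weights on its `k`-dimensional cones, subject to the balancing condition.
Only the values of `weight` on the `k`-dimensional cones are meaningful. -/
structure TropicalFan (n k : ℕ) extends Fan n where
  pure : ∀ σ ∈ cones, (∀ σ' ∈ cones, σ ≤ σ' → σ' = σ) → dim σ = k
  weight : Cone n → ℕ
  balanced : IsBalanced toFan k weight

namespace TropicalFan

/-- The facets, i.e. the cones of dimension `k`. -/
noncomputable def facets {n k : ℕ} (X : TropicalFan n k) : Finset (Cone n) := X.conesOfDim k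

/-- The cones of the subfan `X*` formed by the facets of non-zero weight and their faces. -/
def essentialCones {n k : ℕ} (X : TropicalFan n k) : Set (Cone n) :=
  {τ | τ ∈ X.cones ∧ ∃ σ ∈ X.facets, X.weight σ ≠ 0 ∧ τ ≤ σ}

/-- The support `|X*|`. -/
def support {n k : ℕ} (X : TropicalFan n k) : Set (Fin n → ℝ) :=
  {x | ∃ σ ∈ X.essentialCones, x ∈ σ}

/-- `X` is a refinement of `Y`: both have the same support, every cone of `X` lies in a cone of
`Y`, and the weights of `X` are induced from those of `Y` (facets of weight zero are ignored). -/
def IsRefinement {n k : ℕ} (X Y : TropicalFan n k) : Prop :=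
  X.support = Y.support ∧
    (∀ τ ∈ X.essentialCones, ∃ τ' ∈ Y.essentialCones, τ ≤ τ') ∧
    ∀ σ ∈ X.facets, X.weight σ ≠ 0 →
      ∀ σ' ∈ Y.facets, Y.weight σ' ≠ 0 → σ ≤ σ' → X.weight σ = Y.weight σ'

/-- Two tropical fans represent the same cycle, `[X] = [Y]`: they have a common refinement. -/
def Equivalent {n k : ℕ} (X Y : TropicalFan n k) : Prop :=
  ∃ R : TropicalFan n k, R.IsRefinement X ∧ R.IsRefinement Y

end TropicalFan

/-! ### Tropical intersection products -/

/-- `T` is linear on the cone `σ`. -/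
def IsLinearOn {n : ℕ} (T : (Fin n → ℝ) → ℝ) (σ : Cone n) : Prop :=
  ∃ f : (Fin n → ℝ) →ₗ[ℝ] ℝ, ∀ x ∈ σ, f x = T x

/-- A linear functional extending `T` restricted to `σ`. On `⟨σ⟩` it is the unique linear
functional `T_σ` which agrees with `T` on `σ`. (It is `0` if `T` is not linear on `σ`.) -/
noncomputable def linearPart {n : ℕ} (T : (Fin n → ℝ) → ℝ) (σ : Cone n) :
    (Fin n → ℝ) →ₗ[ℝ] ℝ :=
  open Classical in if h : IsLinearOn T σ then h.choose else 0

/-- `T` is linear on every cone of `X`, and `Y` is the intersection product of `T` with `X` formed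
on the cones of `X`: the cones of `Y` are those of `X` of dimension at most `k`, and the weight of
a `k`-dimensional cone `τ` is `∑ T_σ(ω(σ) v_{σ/τ}) - T_τ(∑ ω(σ) v_{σ/τ})`, the sums running over
the `(k+1)`-dimensional cones `σ > τ` of `X`. -/
def IsFanProduct {n k : ℕ} (T : (Fin n → ℝ) → ℝ) (X : TropicalFan n (k + 1))
    (Y : TropicalFan n k) : Prop :=
  (∀ σ ∈ X.cones, IsLinearOn T σ) ∧
    (∀ τ : Cone n, τ ∈ Y.cones ↔ τ ∈ X.cones ∧ dim τ ≤ k) ∧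
    ∃ v : Cone n → Cone n → Fin n → ℤ, IsNormalSystem X.toFan (k + 1) v ∧
      ∀ τ ∈ Y.facets, (Y.weight τ : ℝ) =
        ∑ σ ∈ X.above (k + 1) τ, linearPart T σ ((X.weight σ : ℝ) • latticePt (v τ σ))
          - linearPart T τ (∑ σ ∈ X.above (k + 1) τ, (X.weight σ : ℝ) • latticePt (v τ σ))

/-- `T · [X] = [Y]` as cycles. -/
def IsProduct {n k : ℕ} (T : (Fin n → ℝ) → ℝ) (X : TropicalFan n (k + 1))
    (Y : TropicalFan n k) : Prop :=
  ∃ (X' : TropicalFan n (k + 1)) (Y' : TropicalFan n k),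
    X.Equivalent X' ∧ IsFanProduct T X' Y' ∧ Y'.Equivalent Y

/-- `T₁ · T₂ · [X] = m`: the `0`-cycle `T₁ · (T₂ · [X])` is the origin with multiplicity `m`. -/
def IntersectionNumberEq {n : ℕ} (T₁ T₂ : (Fin n → ℝ) → ℝ) (X : TropicalFan n 2) (m : ℕ) : Prop :=
  ∃ (Y : TropicalFan n 1) (Z : TropicalFan n 0),
    IsProduct T₂ X Y ∧ IsProduct T₁ Y Z ∧ Z.weight ⊥ = m

/-! ### Tropical binomials and galleries -/

/-- The linear functional on `ℝⁿ` with integer coefficients `l`. -/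
noncomputable def intFunctional {n : ℕ} (l : Fin n → ℤ) : (Fin n → ℝ) →ₗ[ℝ] ℝ :=
  ∑ i, (l i : ℝ) • LinearMap.proj i

/-- A tropical binomial `max(l, h)`, with `l`, `h` linear functionals with integer coefficients. -/
structure TropicalBinomial (n : ℕ) where
  l : Fin n → ℤ
  h : Fin n → ℤ

/-- The function `max(l, h)` on `ℝⁿ`. -/
noncomputable def TropicalBinomial.toFun {n : ℕ} (L : TropicalBinomial n) (x : Fin n → ℝ) : ℝ :=
  max (intFunctional L.l x) (intFunctional L.h x)

/-- The hypersurface `V(max(l, h)) = {x | l x = h x}` (for `l ≠ h`), a linear hyperplane. -/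
noncomputable def TropicalBinomial.hypersurface {n : ℕ} (L : TropicalBinomial n) :
    Submodule ℝ (Fin n → ℝ) :=
  LinearMap.ker (intFunctional L.l - intFunctional L.h)

/-- The gallery `g(F, L₁, L₂)`: the facets `σ` of `F` with
`dim (V(L₁) ∩ V(L₂) + ⟨σ⟩) = n`. -/
noncomputable def gallery {n : ℕ} (F : TropicalFan n 2) (L₁ L₂ : TropicalBinomial n) :
    Set (Cone n) :=
  {σ | σ ∈ F.facets ∧
    Module.finrank ℝ ↥((L₁.hypersurface ⊓ L₂.hypersurface) ⊔ linSpan σ) = n}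

/-- The support of the gallery: the union of its facets. -/
noncomputable def gallerySupport {n : ℕ} (F : TropicalFan n 2) (L₁ L₂ : TropicalBinomial n) :
    Set (Fin n → ℝ) :=
  {x | ∃ σ ∈ gallery F L₁ L₂, x ∈ σ}

/-- `ad(ρ)`: the facets of `F` that contain `ρ`. -/
noncomputable def ad {n : ℕ} (F : TropicalFan n 2) (ρ : Cone n) : Set (Cone n) :=
  {σ | σ ∈ F.facets ∧ ρ ≤ σ}

/-- The adjacency graph of the gallery: its vertices are the facets of the gallery, and two
different facets are adjacent if they have a common ray of `F`. -/
def galleryGraph {n : ℕ} (F : TropicalFan n 2) (L₁ L₂ : TropicalBinomial n) :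
    SimpleGraph (gallery F L₁ L₂) where
  Adj σ σ' := σ ≠ σ' ∧ ∃ ρ ∈ F.conesOfDim 1, ρ ≤ (σ : Cone n) ∧ ρ ≤ (σ' : Cone n)
  symm := ⟨fun _ _ ⟨hne, ρ, hρ, h, h'⟩ => ⟨hne.symm, ρ, hρ, h', h⟩⟩
  loopless := ⟨fun _ h => h.1 rfl⟩

end TropicalGallery

namespace TropicalGallery

variable {n k : ℕ}

/-! ### Cones, spans and faces -/

/-! The differences `l - h` of the two binomials form a linear map `planeMap` to the plane with
kernel V(L₁) ∩ V(L₂). Once it is onto, the gallery consists of the facets whose span it maps onto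
the plane. Give each such facet its weight times the lattice index of the map on its span, and count
with these multiplicities the facets whose image contains a direction q, every image losing the last
of its two sides in counterclockwise order. As q turns, the count changes by projected balancing
sums, so it does not depend on q ≠ 0 (`halfOpenDegree_eq`). For generic q it is invariant under
refinement (`IsRefinement.fibreDegree_eq`), and at (1, 0) on a suitable refinement it is the
intersection number (`IntersectionNumberEq.degree_eq`).

Here the degree is 1 and the multiplicities are positive integers, so every direction lies in
exactly one half-open image. Thus no two facets share their first ray. Balancing at a ray needs
terms of both signs: positive ones come from facets where the ray is first, negative ones from
facets where it is last. So first rays and last rays are the same rays, and counting makes `last`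
injective too (`last_injOn`). Each ray of the gallery is then the first ray of one facet and the
last ray of one other.

For connectedness, cut the weights down to a union of components. Projected balancing survives, so
the new count is a nonzero constant; the components cover every direction, and by uniqueness they
are the whole gallery (`mem_of_adjacency_closed`). -/

lemma mem_linSpan {σ : Cone n} {x : Fin n → ℝ} (hx : x ∈ σ) : x ∈ linSpan σ :=
  Submodule.subset_span hx

lemma linSpan_mono {σ τ : Cone n} (h : σ ≤ τ) : linSpan σ ≤ linSpan τ :=
  Submodule.span_mono h

lemma linSpan_eq_of_le_of_dim_le {σ τ : Cone n} (h : σ ≤ τ) (hd : dim τ ≤ dim σ) :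
    linSpan σ = linSpan τ :=
  Submodule.eq_of_le_of_finrank_le (linSpan_mono h) hd

lemma linSpan_bot : linSpan (⊥ : Cone n) = ⊥ := by
  rw [linSpan, Submodule.span_eq_bot]
  intro x hx
  exact hx

lemma dim_bot : dim (⊥ : Cone n) = 0 := by
  rw [dim, linSpan_bot, finrank_bot]

lemma eq_zero_of_dim_eq_zero {σ : Cone n} (h : dim σ = 0) {x : Fin n → ℝ} (hx : x ∈ σ) :
    x = 0 := by
  have h' : linSpan σ = ⊥ := Submodule.finrank_eq_zero.1 h
  have := mem_linSpan hx
  rwa [h', Submodule.mem_bot] at this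

lemma eq_bot_of_dim_eq_zero {σ : Cone n} (h : dim σ = 0) : σ = ⊥ :=
  (Submodule.eq_bot_iff _).2 fun _ hx => eq_zero_of_dim_eq_zero h hx

lemma exists_sub_of_mem_linSpan {σ : Cone n} {x : Fin n → ℝ} (hx : x ∈ linSpan σ) :
    ∃ y ∈ σ, ∃ z ∈ σ, x = y - z := by
  induction hx using Submodule.span_induction with
  | mem x hx => exact ⟨x, hx, 0, σ.zero_mem, by simp⟩
  | zero => exact ⟨0, σ.zero_mem, 0, σ.zero_mem, by simp⟩
  | add x y _ _ hx hy =>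
    obtain ⟨a, ha, b, hb, rfl⟩ := hx
    obtain ⟨c, hc, d, hd, rfl⟩ := hy
    exact ⟨a + c, σ.add_mem ha hc, b + d, σ.add_mem hb hd, by abel⟩
  | smul t x _ hx =>
    obtain ⟨a, ha, b, hb, rfl⟩ := hx
    rcases le_total 0 t with ht | ht
    · exact ⟨t • a, PointedCone.smul_mem σ ht ha, t • b, PointedCone.smul_mem σ ht hb,
        smul_sub _ _ _⟩
    · refine ⟨(-t) • b, PointedCone.smul_mem σ (by linarith) hb, (-t) • a,
        PointedCone.smul_mem σ (by linarith) ha, ?_⟩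
      rw [smul_sub, neg_smul, neg_smul]; abel

/-- Write x = y - z with y, z in `τ`: then x + z lies in the face `τ`, hence so does x. -/
lemma mem_of_mem_linSpan_face {τ σ : Cone n} (h : τ.IsFaceOf σ) {x : Fin n → ℝ} (hx : x ∈ σ)
    (hx' : x ∈ linSpan τ) : x ∈ τ := by
  obtain ⟨y, hy, z, hz, rfl⟩ := exists_sub_of_mem_linSpan hx'
  exact h.mem_of_add_mem_left hx (h.le hz) (by simpa using hy)

lemma eq_of_face_of_dim_le {τ σ : Cone n} (h : τ.IsFaceOf σ) (hd : dim σ ≤ dim τ) : τ = σ := by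
  refine le_antisymm h.le fun x hx => mem_of_mem_linSpan_face h hx ?_
  rw [linSpan_eq_of_le_of_dim_le h.le hd]
  exact mem_linSpan hx

namespace Fan

lemma mem_conesOfDim {X : Fan n} {d : ℕ} {σ : Cone n} :
    σ ∈ X.conesOfDim d ↔ σ ∈ X.cones ∧ dim σ = d := by
  simp [conesOfDim]

lemma mem_above {X : Fan n} {d : ℕ} {τ σ : Cone n} :
    σ ∈ X.above d τ ↔ (σ ∈ X.cones ∧ dim σ = d) ∧ τ ≤ σ := by
  simp [above, mem_conesOfDim]

lemma isFaceOf_of_le (X : Fan n) {τ σ : Cone n} (hτ : τ ∈ X.cones) (hσ : σ ∈ X.cones)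
    (h : τ ≤ σ) : τ.IsFaceOf σ := by
  have := (X.inter_face τ hτ σ hσ).2
  rwa [inf_eq_left.2 h] at this

lemma inf_mem (X : Fan n) {τ σ : Cone n} (hτ : τ ∈ X.cones) (hσ : σ ∈ X.cones) :
    τ ⊓ σ ∈ X.cones :=
  X.face_mem _ hτ _ (X.inter_face τ hτ σ hσ).1

/-- The intersection is a common face containing x, so it cannot have smaller dimension and equals
both cones. -/
lemma eq_of_mem_of_mem (X : Fan n) {d : ℕ} {σ₁ σ₂ : Cone n} (h₁ : σ₁ ∈ X.conesOfDim d)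
    (h₂ : σ₂ ∈ X.conesOfDim d) {x : Fin n → ℝ} (hx₁ : x ∈ σ₁) (hx₂ : x ∈ σ₂)
    (hx : ∀ τ ∈ X.cones, dim τ < d → x ∉ τ) : σ₁ = σ₂ := by
  rw [mem_conesOfDim] at h₁ h₂
  have hd : ¬ dim (σ₁ ⊓ σ₂) < d := fun h => hx _ (X.inf_mem h₁.1 h₂.1) h ⟨hx₁, hx₂⟩
  obtain ⟨f₁, f₂⟩ := X.inter_face _ h₁.1 _ h₂.1
  rw [← eq_of_face_of_dim_le f₁ (by omega), eq_of_face_of_dim_le f₂ (by omega)]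

lemma bot_mem (X : Fan n) : (⊥ : Cone n) ∈ X.cones := by
  obtain ⟨σ, hσ⟩ := X.nonempty
  refine X.face_mem σ hσ ⊥ ⟨bot_le, fun {x y a} hx hy ha h => ?_⟩
  by_contra hne
  rw [Submodule.mem_bot] at h hne
  refine X.stronglyConvex σ hσ x hx hne ?_
  have : -x = a⁻¹ • y := by
    rw [eq_inv_smul_iff₀ ha.ne', smul_neg]
    exact neg_eq_of_add_eq_zero_right h
  rw [this]
  exact PointedCone.smul_mem σ (inv_nonneg.2 ha.le) hy

end Fan

/-! ### Lattice points -/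

@[simp] lemma latticePt_add (x y : Fin n → ℤ) : latticePt (x + y) = latticePt x + latticePt y := by
  ext; simp [latticePt]

@[simp] lemma latticePt_sub (x y : Fin n → ℤ) : latticePt (x - y) = latticePt x - latticePt y := by
  ext; simp [latticePt]

@[simp] lemma latticePt_zero : latticePt (0 : Fin n → ℤ) = 0 := by
  ext; simp [latticePt]

@[simp] lemma latticePt_smul (m : ℤ) (x : Fin n → ℤ) : latticePt (m • x) = (m : ℝ) • latticePt x := by
  ext; simp [latticePt]

lemma latticePt_injective : Function.Injective (latticePt (n := n)) := fun x y h => by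
  ext i
  have := congrFun h i
  simpa [latticePt] using this

lemma linSpan_le_of_isRational {σ : Cone n} (hσ : IsRational σ) {P : Submodule ℝ (Fin n → ℝ)}
    (h : ∀ z : Fin n → ℤ, latticePt z ∈ σ → latticePt z ∈ P) : linSpan σ ≤ P := by
  obtain ⟨S, hS⟩ := hσ
  have : σ ≤ PointedCone.ofSubmodule P := by
    conv_lhs => rw [hS]
    rw [Submodule.span_le]
    rintro _ ⟨z, hz, rfl⟩
    refine h z ?_
    rw [hS]
    exact Submodule.subset_span ⟨z, hz, rfl⟩
  exact Submodule.span_le.2 this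

/-! ### Primitive generators -/

lemma IsPrimitiveGenerator.exists_eq_smul {ρ : Cone n} {u : Fin n → ℤ}
    (h : IsPrimitiveGenerator ⊥ ρ u) {w : Fin n → ℤ} (hw : latticePt w ∈ linSpan ρ) :
    ∃ m : ℤ, w = m • u := by
  obtain ⟨m, hm⟩ := h.2 w hw
  refine ⟨m, ?_⟩
  rw [linSpan_bot, Submodule.mem_bot, ← latticePt_zero] at hm
  exact sub_eq_zero.1 (latticePt_injective hm)

lemma IsPrimitiveGenerator.linSpan_eq {ρ : Cone n} {u : Fin n → ℤ} (hρ : IsRational ρ)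
    (h : IsPrimitiveGenerator ⊥ ρ u) : linSpan ρ = Submodule.span ℝ {latticePt u} := by
  refine le_antisymm (linSpan_le_of_isRational hρ fun z hz => ?_) ?_
  · obtain ⟨m, rfl⟩ := h.exists_eq_smul (mem_linSpan hz)
    rw [latticePt_smul]
    exact Submodule.smul_mem _ _ (Submodule.mem_span_singleton_self _)
  · rw [Submodule.span_singleton_le_iff_mem]
    exact mem_linSpan h.1

lemma IsPrimitiveGenerator.ne_zero {ρ : Cone n} {u : Fin n → ℤ} (hρ : IsRational ρ)
    (hd : dim ρ = 1) (h : IsPrimitiveGenerator ⊥ ρ u) : latticePt u ≠ 0 := by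
  intro h0
  rw [dim, h.linSpan_eq hρ, h0, Submodule.span_zero_singleton, finrank_bot] at hd
  exact zero_ne_one hd

lemma IsPrimitiveGenerator.exists_nonneg_smul {ρ : Cone n} {u : Fin n → ℤ} (hρ : IsRational ρ)
    (hs : IsStronglyConvex ρ) (hd : dim ρ = 1) (h : IsPrimitiveGenerator ⊥ ρ u)
    {x : Fin n → ℝ} (hx : x ∈ ρ) : ∃ c : ℝ, 0 ≤ c ∧ x = c • latticePt u := by
  have hx' := mem_linSpan hx
  rw [h.linSpan_eq hρ, Submodule.mem_span_singleton] at hx'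
  obtain ⟨c, rfl⟩ := hx'
  refine ⟨c, ?_, rfl⟩
  by_contra hc
  push Not at hc
  refine hs _ hx (smul_ne_zero hc.ne (h.ne_zero hρ hd)) ?_
  rw [← neg_smul]
  exact PointedCone.smul_mem ρ (by linarith) h.1

lemma exists_isPrimitiveGenerator_bot {ρ : Cone n} (hρ : IsRational ρ) (hd : dim ρ = 1) :
    ∃ u : Fin n → ℤ, IsPrimitiveGenerator ⊥ ρ u := by
  obtain ⟨z, hzρ, hz0⟩ : ∃ z : Fin n → ℤ, latticePt z ∈ ρ ∧ z ≠ 0 := by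
    by_contra! hcon
    have : linSpan ρ ≤ ⊥ := linSpan_le_of_isRational hρ fun z hz => by
      rw [hcon z hz, latticePt_zero]; exact Submodule.zero_mem _
    rw [dim, le_bot_iff.1 this, finrank_bot] at hd
    exact zero_ne_one hd
  obtain ⟨i₀, hi₀⟩ := Function.ne_iff.1 hz0
  obtain ⟨u, hu, hg⟩ := Finset.extract_gcd z (s := Finset.univ) ⟨i₀, Finset.mem_univ _⟩
  set g := Finset.univ.gcd z with hgdef
  have hzu : z = g • u := by ext i; simpa using hu i (Finset.mem_univ i)
  have hg0 : g ≠ 0 := fun h => hz0 (by rw [hzu, h, zero_smul])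
  have hgpos : 0 < g := lt_of_le_of_ne
    (by rw [hgdef, ← Finset.normalize_gcd]; exact Int.nonneg_of_normalize_eq_self (by simp)) hg0.symm
  have hgR : (0 : ℝ) < g := by exact_mod_cast hgpos
  have huρ : latticePt u ∈ ρ := by
    have : latticePt u = (g : ℝ)⁻¹ • latticePt z := by
      rw [hzu, latticePt_smul, inv_smul_smul₀ hgR.ne']
    rw [this]
    exact PointedCone.smul_mem ρ (inv_nonneg.2 hgR.le) hzρ
  have hu0 : latticePt u ≠ 0 := fun h => hz0 <| by
    rw [hzu, latticePt_injective (h.trans latticePt_zero.symm), smul_zero]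
  refine ⟨u, huρ, fun w hw => ?_⟩
  obtain ⟨c, hc⟩ : ∃ c : ℝ, c • latticePt u = latticePt w := by
    have := (finrank_eq_one_iff_of_nonzero' (⟨latticePt u, mem_linSpan huρ⟩ : linSpan ρ)
      (by simpa [Subtype.ext_iff] using hu0)).1 hd ⟨latticePt w, hw⟩
    simpa [Subtype.ext_iff] using this
  -- Bézout for the coprime entries of u: if c • u = w is integral, then c = ∑ wᵢ tᵢ is an integer.
  obtain ⟨t, ht⟩ := Finset.gcd_eq_sum_mul Finset.univ u
  have hm : c = ((∑ i, w i * t i : ℤ) : ℝ) := by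
    have h1 : (1 : ℝ) = ∑ i, (u i : ℝ) * t i := by exact_mod_cast hg.symm.trans ht
    push_cast
    calc c = c * ∑ i, (u i : ℝ) * t i := by rw [← h1, mul_one]
      _ = ∑ i, (w i : ℝ) * t i := by
        rw [Finset.mul_sum]
        refine Finset.sum_congr rfl fun i _ => ?_
        have : c * (u i : ℝ) = w i := congrFun hc i
        rw [← mul_assoc, this]
  refine ⟨∑ i, w i * t i, ?_⟩
  rw [latticePt_sub, latticePt_smul, ← hm, hc, sub_self]
  exact Submodule.zero_mem _

lemma IsPrimitiveGenerator.exists_eq_add {ρ σ : Cone n} {u v : Fin n → ℤ}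
    (hu : IsPrimitiveGenerator ⊥ ρ u) (hv : IsPrimitiveGenerator ρ σ v) {w : Fin n → ℤ}
    (hw : latticePt w ∈ linSpan σ) : ∃ l m : ℤ, w = l • u + m • v := by
  obtain ⟨m, hm⟩ := hv.2 w hw
  obtain ⟨l, hl⟩ := hu.exists_eq_smul hm
  exact ⟨l, m, by rw [← hl, sub_add_cancel]⟩

lemma IsPrimitiveGenerator.linSpan_le {ρ σ : Cone n} {v : Fin n → ℤ} (hσ : IsRational σ)
    (h : IsPrimitiveGenerator ρ σ v) :
    linSpan σ ≤ linSpan ρ ⊔ Submodule.span ℝ {latticePt v} := by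
  refine linSpan_le_of_isRational hσ fun z hz => ?_
  obtain ⟨m, hm⟩ := h.2 z (mem_linSpan hz)
  rw [latticePt_sub, latticePt_smul] at hm
  rw [← sub_add_cancel (latticePt z) ((m : ℝ) • latticePt v)]
  exact Submodule.add_mem_sup hm (Submodule.smul_mem _ _ (Submodule.mem_span_singleton_self _))

lemma IsPrimitiveGenerator.notMem_linSpan {ρ σ : Cone n} {v : Fin n → ℤ} (hσ : IsRational σ)
    (hd : dim ρ < dim σ) (h : IsPrimitiveGenerator ρ σ v) : latticePt v ∉ linSpan ρ := by
  intro hv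
  have := h.linSpan_le hσ
  rw [sup_eq_left.2 ((Submodule.span_singleton_le_iff_mem _ _).2 hv)] at this
  exact (Submodule.finrank_mono this).not_gt hd

/-- Two primitive generators from a face `ρ` to `σ` differ by an element of `⟨ρ⟩`. -/
lemma IsPrimitiveGenerator.sub_mem_linSpan {ρ σ : Cone n} {v v' : Fin n → ℤ} (hσ : IsRational σ)
    (hf : ρ.IsFaceOf σ) (hd : dim ρ < dim σ) (h : IsPrimitiveGenerator ρ σ v)
    (h' : IsPrimitiveGenerator ρ σ v') : latticePt v - latticePt v' ∈ linSpan ρ := by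
  have hv := h.notMem_linSpan hσ hd
  obtain ⟨m, hm⟩ := h.2 v' (mem_linSpan h'.1)
  obtain ⟨m', hm'⟩ := h'.2 v (mem_linSpan h.1)
  rw [latticePt_sub, latticePt_smul] at hm hm'
  -- Modulo ⟨ρ⟩, v' = m v and v = m' v', while v is nonzero there; so m' m = 1.
  have key : ((1 : ℝ) - m' * m) • latticePt v ∈ linSpan ρ := by
    have := Submodule.add_mem _ hm' (Submodule.smul_mem _ (m' : ℝ) hm)
    convert this using 1
    module
  have h1 : (1 : ℝ) - m' * m = 0 := by
    by_contra hne
    exact hv ((Submodule.smul_mem_iff _ hne).1 key)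
  have h2 : m' * m = 1 := by
    have : (m' : ℝ) * m = 1 := by linarith
    exact_mod_cast this
  rcases Int.eq_one_or_neg_one_of_mul_eq_one h2 with rfl | rfl
  · simpa using hm'
  -- The sign -1 would put v + v' into the face `ρ`, and then v itself.
  · exfalso
    have hsum : latticePt v + latticePt v' ∈ ρ :=
      mem_of_mem_linSpan_face hf (σ.add_mem h.1 h'.1) (by simpa using hm')
    exact hv (mem_linSpan (hf.mem_of_add_mem_left h.1 h'.1 hsum))

lemma IsBalanced.sum_mem {X : Fan n} {d : ℕ} {ω : Cone n → ℕ} (h : IsBalanced X d ω)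
    {v : Cone n → Cone n → Fin n → ℤ} (hv : IsNormalSystem X d v) {τ : Cone n}
    (hτ : τ ∈ X.cones) (hd : dim τ + 1 = d) :
    ∑ σ ∈ X.above d τ, (ω σ : ℝ) • latticePt (v τ σ) ∈ linSpan τ := by
  obtain ⟨v', hv', hb⟩ := h
  rw [← Submodule.sub_mem_iff_left _ (hb τ hτ hd), ← Finset.sum_sub_distrib]
  refine Submodule.sum_mem _ fun σ hσ => ?_
  rw [← smul_sub]
  have hσ' := Fan.mem_above.1 hσ
  exact Submodule.smul_mem _ _ ((hv τ hτ hd σ hσ).sub_mem_linSpan (X.rational σ hσ'.1.1)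
    (X.isFaceOf_of_le hτ hσ'.1.1 hσ'.2) (by omega) (hv' τ hτ hd σ hσ))

end TropicalGallery

namespace TropicalGallery

variable {n k : ℕ} {V : Type*} [AddCommGroup V] [Module ℝ V]

/-! ### Fibre degrees and refinements -/

namespace TropicalFan

lemma mem_facets {X : TropicalFan n k} {σ : Cone n} :
    σ ∈ X.facets ↔ σ ∈ X.cones ∧ dim σ = k :=
  Fan.mem_conesOfDim

/-- The fibre `A⁻¹(q)` meets every facet at most once, and no cone of smaller dimension. -/
def Transversal (X : TropicalFan n k) (A : (Fin n → ℝ) →ₗ[ℝ] V) (q : V) : Prop :=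
  (∀ τ ∈ X.cones, dim τ < k → ∀ x ∈ τ, A x ≠ q) ∧
    ∀ σ ∈ X.facets, ∀ x ∈ σ, ∀ y ∈ σ, A x = q → A y = q → x = y

open Classical in
/-- The sum over the facets `σ` meeting `A⁻¹(q)` of `ω(σ)`, multiplied by a quantity depending only
on the span of `σ`. -/
noncomputable def fibreDegree (X : TropicalFan n k) (A : (Fin n → ℝ) →ₗ[ℝ] V) (q : V)
    (f : Submodule ℝ (Fin n → ℝ) → ℝ) : ℝ :=
  ∑ σ ∈ X.facets, if ∃ x ∈ σ, A x = q then (X.weight σ : ℝ) * f (linSpan σ) else 0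

lemma IsRefinement.exists_facet {X Y : TropicalFan n k} (h : X.IsRefinement Y) {σ : Cone n}
    (hσ : σ ∈ X.facets) (hw : X.weight σ ≠ 0) :
    ∃ σ' ∈ Y.facets, Y.weight σ' ≠ 0 ∧ σ ≤ σ' := by
  obtain ⟨τ, ⟨_, σ', h1, h2, h3⟩, hτ⟩ := h.2.1 σ ⟨(mem_facets.1 hσ).1, σ, hσ, hw, le_rfl⟩
  exact ⟨σ', h1, h2, hτ.trans h3⟩

lemma IsRefinement.exists_facet_of_mem {X Y : TropicalFan n k} (h : X.IsRefinement Y) {σ : Cone n}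
    (hσ : σ ∈ Y.facets) (hw : Y.weight σ ≠ 0) {x : Fin n → ℝ} (hx : x ∈ σ) :
    ∃ σ' ∈ X.facets, X.weight σ' ≠ 0 ∧ x ∈ σ' := by
  have : x ∈ Y.support := ⟨σ, ⟨(mem_facets.1 hσ).1, σ, hσ, hw, le_rfl⟩, hx⟩
  rw [← h.1] at this
  obtain ⟨τ, ⟨_, σ', h1, h2, h3⟩, hτ⟩ := this
  exact ⟨σ', h1, h2, h3 hτ⟩

/-- Sending a facet of `X` to a facet of `Y` containing it is a bijection between the facets of
nonzero weight that meet the fibre: transversality makes the fibre point of a facet unique and keeps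
it off all smaller cones. Weights agree by refinement and spans by dimension, which is why `f` may
see only the span. -/
lemma IsRefinement.fibreDegree_eq {X Y : TropicalFan n k} (h : X.IsRefinement Y)
    {A : (Fin n → ℝ) →ₗ[ℝ] V} {q : V} (hX : X.Transversal A q) (hY : Y.Transversal A q)
    (f : Submodule ℝ (Fin n → ℝ) → ℝ) : X.fibreDegree A q f = Y.fibreDegree A q f := by
  classical
  have key : ∀ Z : TropicalFan n k, Z.fibreDegree A q f =
      ∑ σ ∈ Z.facets.filter (fun σ => Z.weight σ ≠ 0 ∧ ∃ x ∈ σ, A x = q),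
        (Z.weight σ : ℝ) * f (linSpan σ) := by
    intro Z
    rw [fibreDegree, Finset.sum_filter]
    refine Finset.sum_congr rfl fun σ _ => ?_
    by_cases h0 : Z.weight σ = 0 <;> simp [h0]
  rw [key, key]
  have ex : ∀ σ : Cone n, ∃ σ' : Cone n, σ ∈ X.facets → X.weight σ ≠ 0 →
      σ' ∈ Y.facets ∧ Y.weight σ' ≠ 0 ∧ σ ≤ σ' := by
    intro σ
    by_cases hσ : σ ∈ X.facets ∧ X.weight σ ≠ 0
    · obtain ⟨σ', h1, h2, h3⟩ := h.exists_facet hσ.1 hσ.2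
      exact ⟨σ', fun _ _ => ⟨h1, h2, h3⟩⟩
    · exact ⟨σ, fun h1 h2 => absurd ⟨h1, h2⟩ hσ⟩
  choose i hi using ex
  have sep : ∀ {Z : TropicalFan n k}, Z.Transversal A q → ∀ {σ₁ σ₂ : Cone n}, σ₁ ∈ Z.facets →
      σ₂ ∈ Z.facets → ∀ {x}, x ∈ σ₁ → x ∈ σ₂ → A x = q → σ₁ = σ₂ :=
    fun hZ _ _ h1 h2 _ hx1 hx2 hq =>
      Fan.eq_of_mem_of_mem _ h1 h2 hx1 hx2 fun τ hτ hd hx => hZ.1 τ hτ hd _ hx hq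
  refine Finset.sum_bij (fun σ _ => i σ) ?_ ?_ ?_ ?_
  · intro σ hσ
    obtain ⟨hσ, hw, x, hx, hq⟩ := Finset.mem_filter.1 hσ
    obtain ⟨h1, h2, h3⟩ := hi σ hσ hw
    exact Finset.mem_filter.2 ⟨h1, h2, x, h3 hx, hq⟩
  · intro σ₁ hσ₁ σ₂ hσ₂ heq
    obtain ⟨hσ₁, hw₁, x₁, hx₁, hq₁⟩ := Finset.mem_filter.1 hσ₁
    obtain ⟨hσ₂, hw₂, x₂, hx₂, hq₂⟩ := Finset.mem_filter.1 hσ₂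
    obtain ⟨h1, -, h3⟩ := hi σ₁ hσ₁ hw₁
    obtain ⟨-, -, h3'⟩ := hi σ₂ hσ₂ hw₂
    have : x₁ = x₂ := hY.2 _ h1 _ (h3 hx₁) _ (heq ▸ h3' hx₂) hq₁ hq₂
    subst this
    exact sep hX hσ₁ hσ₂ hx₁ hx₂ hq₁
  · intro σ' hσ'
    obtain ⟨hσ', hw, x, hx, hq⟩ := Finset.mem_filter.1 hσ'
    obtain ⟨σ, h1, h2, h3⟩ := h.exists_facet_of_mem hσ' hw hx
    obtain ⟨g1, -, g3⟩ := hi σ h1 h2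
    exact ⟨σ, Finset.mem_filter.2 ⟨h1, h2, x, h3, hq⟩, sep hY g1 hσ' (g3 h3) hx hq⟩
  · intro σ hσ
    obtain ⟨hσ, hw, -⟩ := Finset.mem_filter.1 hσ
    obtain ⟨h1, h2, h3⟩ := hi σ hσ hw
    rw [h.2.2 σ hσ hw _ h1 h2 h3, linSpan_eq_of_le_of_dim_le h3
      ((mem_facets.1 h1).2.trans (mem_facets.1 hσ).2.symm).le]

lemma injOn_of_map_linSpan_eq_top [FiniteDimensional ℝ V] {σ : Cone n}
    {A : (Fin n → ℝ) →ₗ[ℝ] V} (hd : dim σ = Module.finrank ℝ V) (h : (linSpan σ).map A = ⊤)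
    {x y : Fin n → ℝ} (hx : x ∈ linSpan σ) (hy : y ∈ linSpan σ) (hxy : A x = A y) : x = y := by
  have hsurj : Function.Surjective (A.domRestrict (linSpan σ)) := by
    rw [← LinearMap.range_eq_top, LinearMap.range_domRestrict, h]
  have hinj := (LinearMap.injective_iff_surjective_of_finrank_eq_finrank hd).2 hsurj
  exact congrArg Subtype.val (@hinj ⟨x, hx⟩ ⟨y, hy⟩ hxy)

lemma transversal_of_forall_notMem [FiniteDimensional ℝ V] (X : TropicalFan n k)
    {A : (Fin n → ℝ) →ₗ[ℝ] V} {q : V} (hk : Module.finrank ℝ V = k)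
    (h : ∀ τ ∈ X.cones, (linSpan τ).map A ≠ ⊤ → q ∉ (linSpan τ).map A) : X.Transversal A q := by
  refine ⟨fun τ hτ hd x hx hq => h τ hτ (fun htop => ?_) ⟨x, mem_linSpan hx, hq⟩,
    fun σ hσ x hx y hy hq hq' => ?_⟩
  · have := Submodule.finrank_map_le A (linSpan τ)
    rw [htop, finrank_top, hk] at this
    exact absurd hd this.not_gt
  · obtain ⟨hσ, hd⟩ := mem_facets.1 hσ
    refine injOn_of_map_linSpan_eq_top (hd.trans hk.symm) ?_ (mem_linSpan hx) (mem_linSpan hy)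
      (hq.trans hq'.symm)
    by_contra hne
    exact h σ hσ hne ⟨x, mem_linSpan hx, hq⟩

/-- In dimension at most 1 the only proper subspace is 0, so no genericity beyond q ≠ 0 is needed.
-/
lemma transversal_of_finrank_le_one [FiniteDimensional ℝ V] (X : TropicalFan n k)
    {A : (Fin n → ℝ) →ₗ[ℝ] V} {q : V} (hk : Module.finrank ℝ V = k) (hk1 : k ≤ 1)
    (hq : k = 1 → q ≠ 0) : X.Transversal A q := by
  refine X.transversal_of_forall_notMem hk fun τ hτ hne hmem => ?_
  rcases Nat.le_one_iff_eq_zero_or_eq_one.1 hk1 with rfl | rfl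
  · have := Module.finrank_zero_iff.1 hk
    exact hne (Subsingleton.elim _ _)
  · have : IsSimpleOrder (Submodule ℝ V) := is_simple_module_of_finrank_eq_one hk
    rcases eq_bot_or_eq_top ((linSpan τ).map A) with h | h
    · rw [h, Submodule.mem_bot] at hmem
      exact hq rfl hmem
    · exact hne h

lemma Equivalent.fibreDegree_eq_of_le_one [FiniteDimensional ℝ V] {X Y : TropicalFan n k}
    (h : X.Equivalent Y) {A : (Fin n → ℝ) →ₗ[ℝ] V} {q : V} (hk : Module.finrank ℝ V = k)
    (hk1 : k ≤ 1) (hq : k = 1 → q ≠ 0) (f : Submodule ℝ (Fin n → ℝ) → ℝ) :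
    X.fibreDegree A q f = Y.fibreDegree A q f := by
  obtain ⟨R, hX, hY⟩ := h
  have ht : ∀ Z : TropicalFan n k, Z.Transversal A q := fun Z =>
    Z.transversal_of_finrank_le_one hk hk1 hq
  rw [← hX.fibreDegree_eq (ht R) (ht X) f, hY.fibreDegree_eq (ht R) (ht Y) f]

/-- Equivalent fans have the same fibre degrees over a point which lies in no proper subspace that is
the image of the span of one of their cones. -/
lemma Equivalent.exists_fibreDegree_eq [FiniteDimensional ℝ V] [Nontrivial V] {X Y : TropicalFan n k}
    (h : X.Equivalent Y) (A : (Fin n → ℝ) →ₗ[ℝ] V) (hk : Module.finrank ℝ V = k) :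
    ∃ q : V, (∀ τ ∈ X.cones ∪ Y.cones, (linSpan τ).map A ≠ ⊤ → q ∉ (linSpan τ).map A) ∧
      ∀ f : Submodule ℝ (Fin n → ℝ) → ℝ, X.fibreDegree A q f = Y.fibreDegree A q f := by
  classical
  obtain ⟨R, hX, hY⟩ := h
  set s : Finset (Submodule ℝ V) :=
    ((X.cones ∪ Y.cones ∪ R.cones).image fun τ => (linSpan τ).map A).erase ⊤ with hs
  -- Finitely many proper real subspaces do not cover `V`.
  have hcov := Subspace.biUnion_ne_univ_of_top_notMem (s := s) (by simp [hs])
  obtain ⟨q, hq⟩ := (Set.ne_univ_iff_exists_notMem _).1 hcov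
  have hgen : ∀ τ ∈ X.cones ∪ Y.cones ∪ R.cones,
      (linSpan τ).map A ≠ ⊤ → q ∉ (linSpan τ).map A := by
    intro τ hτ hne hmem
    exact hq (Set.mem_biUnion
      (Finset.mem_coe.2 (Finset.mem_erase.2 ⟨hne, Finset.mem_image_of_mem _ hτ⟩)) hmem)
  have ht : ∀ Z : TropicalFan n k, Z.cones ⊆ X.cones ∪ Y.cones ∪ R.cones → Z.Transversal A q :=
    fun Z hZ => Z.transversal_of_forall_notMem hk fun τ hτ => hgen τ (hZ hτ)
  have tX := ht X (fun τ hτ => by simp [hτ])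
  have tY := ht Y (fun τ hτ => by simp [hτ])
  have tR := ht R (fun τ hτ => by simp [hτ])
  exact ⟨q, fun τ hτ => hgen τ (Finset.mem_union_left _ hτ), fun f =>
    by rw [← hX.fibreDegree_eq tR tX f, hY.fibreDegree_eq tR tY f]⟩

end TropicalFan

end TropicalGallery

namespace TropicalGallery

variable {n : ℕ}

/-! ### Determinants in the plane -/

/-- The determinant of two vectors of the plane. -/
def det2 (p q : ℝ × ℝ) : ℝ := p.1 * q.2 - p.2 * q.1

lemma det2_swap (p q : ℝ × ℝ) : det2 q p = -det2 p q := by simp only [det2]; ring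

@[simp] lemma det2_self (p : ℝ × ℝ) : det2 p p = 0 := by simp only [det2]; ring

@[simp] lemma det2_zero_right (p : ℝ × ℝ) : det2 p 0 = 0 := by simp [det2]

@[simp] lemma det2_zero_left (p : ℝ × ℝ) : det2 0 p = 0 := by simp [det2]

@[simp] lemma det2_add_right (p q r : ℝ × ℝ) : det2 p (q + r) = det2 p q + det2 p r := by
  simp only [det2, Prod.fst_add, Prod.snd_add]; ring

@[simp] lemma det2_add_left (p q r : ℝ × ℝ) : det2 (p + q) r = det2 p r + det2 q r := by
  simp only [det2, Prod.fst_add, Prod.snd_add]; ring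

@[simp] lemma det2_smul_right (c : ℝ) (p q : ℝ × ℝ) : det2 p (c • q) = c * det2 p q := by
  simp only [det2, Prod.smul_fst, Prod.smul_snd, smul_eq_mul]; ring

@[simp] lemma det2_smul_left (c : ℝ) (p q : ℝ × ℝ) : det2 (c • p) q = c * det2 p q := by
  simp only [det2, Prod.smul_fst, Prod.smul_snd, smul_eq_mul]; ring

lemma det2_sum_right {ι : Type*} (s : Finset ι) (p : ℝ × ℝ) (f : ι → ℝ × ℝ) :
    det2 p (∑ i ∈ s, f i) = ∑ i ∈ s, det2 p (f i) := by
  classical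
  induction s using Finset.induction_on with
  | empty => simp
  | insert i s hi ih => rw [Finset.sum_insert hi, Finset.sum_insert hi, det2_add_right, ih]

/-- Cramer's rule without division. -/
lemma det2_smul_eq (p r q : ℝ × ℝ) : det2 p r • q = det2 q r • p + det2 p q • r := by
  ext <;> simp only [det2, Prod.smul_fst, Prod.smul_snd, Prod.fst_add, Prod.snd_add, smul_eq_mul] <;>
    ring

lemma eq_smul_add_smul_of_det2_ne_zero {p r : ℝ × ℝ} (h : det2 p r ≠ 0) (q : ℝ × ℝ) :
    q = (det2 q r / det2 p r) • p + (det2 p q / det2 p r) • r := by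
  rw [div_eq_inv_mul, div_eq_inv_mul, mul_smul, mul_smul, ← smul_add, ← det2_smul_eq,
    inv_smul_smul₀ h]

lemma exists_smul_of_det2_eq_zero {p q : ℝ × ℝ} (hp : p ≠ 0) (h : det2 p q = 0) :
    ∃ c : ℝ, q = c • p := by
  have hp' : 0 < p.1 ^ 2 + p.2 ^ 2 := by
    by_contra hcon
    have h1 : p.1 = 0 := by nlinarith [sq_nonneg p.1, sq_nonneg p.2]
    have h2 : p.2 = 0 := by nlinarith [sq_nonneg p.1, sq_nonneg p.2]
    exact hp (Prod.ext h1 h2)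
  refine ⟨(p.1 * q.1 + p.2 * q.2) / (p.1 ^ 2 + p.2 ^ 2), ?_⟩
  simp only [det2] at h
  ext
  · simp only [Prod.smul_fst, smul_eq_mul]
    field_simp
    linear_combination (-p.2) * h
  · simp only [Prod.smul_snd, smul_eq_mul]
    field_simp
    linear_combination p.1 * h

/-- The quarter turn of the plane. -/
def quarterTurn (q : ℝ × ℝ) : ℝ × ℝ := (-q.2, q.1)

lemma det2_quarterTurn_pos {q : ℝ × ℝ} (hq : q ≠ 0) : 0 < det2 q (quarterTurn q) := by
  simp only [det2, quarterTurn]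
  by_contra hcon
  exact hq (Prod.ext (show q.1 = 0 by nlinarith [sq_nonneg q.1, sq_nonneg q.2])
    (show q.2 = 0 by nlinarith [sq_nonneg q.1, sq_nonneg q.2]))

lemma map_eq_top_of_det2_ne_zero {A : (Fin n → ℝ) →ₗ[ℝ] ℝ × ℝ} {P : Submodule ℝ (Fin n → ℝ)}
    {x y : Fin n → ℝ} (hx : x ∈ P) (hy : y ∈ P) (h : det2 (A x) (A y) ≠ 0) : P.map A = ⊤ := by
  refine eq_top_iff.2 fun q _ => ?_
  refine ⟨(det2 q (A y) / det2 (A x) (A y)) • x + (det2 (A x) q / det2 (A x) (A y)) • y,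
    P.add_mem (P.smul_mem _ hx) (P.smul_mem _ hy), ?_⟩
  rw [map_add, map_smul, map_smul, ← eq_smul_add_smul_of_det2_ne_zero h]

lemma det2_eq_zero_of_map_ne_top {A : (Fin n → ℝ) →ₗ[ℝ] ℝ × ℝ} {P : Submodule ℝ (Fin n → ℝ)}
    (hP : P.map A ≠ ⊤) {x y : Fin n → ℝ} (hx : x ∈ P) (hy : y ∈ P) : det2 (A x) (A y) = 0 := by
  by_contra h
  exact hP (map_eq_top_of_det2_ne_zero hx hy h)

/-- The indicator of a half-open angle at two directions `q`, `q'`, compared through the position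
of its sides. -/
lemma indicator_angle_sub {p r q q' : ℝ × ℝ} (hpr : 0 < det2 p r) (hq : 0 < det2 q q') :
    ((if 0 ≤ det2 p q ∧ 0 < det2 q r then 1 else 0 : ℝ) -
        if 0 ≤ det2 p q' ∧ 0 < det2 q' r then 1 else 0) =
      (if 0 < det2 q r ∧ 0 ≤ det2 r q' then 1 else 0) -
        if 0 < det2 q p ∧ 0 ≤ det2 p q' then 1 else 0 := by
  -- The Plücker relation excludes the inconsistent sign patterns; the others are read off.
  have key : 0 < det2 p q' * det2 q r - det2 p q * det2 q' r := by
    have : det2 p q' * det2 q r - det2 p q * det2 q' r = det2 p r * det2 q q' := by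
      simp only [det2]; ring
    rw [this]; positivity
  rw [det2_swap p q, det2_swap q' r]
  generalize det2 p q = a at *
  generalize det2 p q' = a' at *
  generalize det2 q r = b at *
  generalize det2 q' r = b' at *
  rcases lt_or_ge a 0 with ha | ha <;> rcases lt_or_ge a' 0 with ha' | ha' <;>
  rcases lt_or_ge 0 b with hb | hb <;> rcases lt_or_ge 0 b' with hb' | hb' <;>
  first
  | (exfalso; nlinarith)
  | simp [ha, ha', hb, hb', not_le.2, not_lt.2]

/-! ### Greatest common divisors of sets of integers and lattice indices -/

/-- The non-negative generator of the ideal of `ℤ` generated by a set. -/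
noncomputable def setGcd (S : Set ℤ) : ℕ :=
  (Submodule.IsPrincipal.generator (Ideal.span S)).natAbs

lemma setGcd_eq {S : Set ℤ} {d : ℤ} (hd : d ∈ S) (h : ∀ s ∈ S, d ∣ s) : setGcd S = d.natAbs := by
  have : Ideal.span S = Ideal.span {d} := by
    refine le_antisymm (Ideal.span_le.2 fun s hs => Ideal.mem_span_singleton.2 (h s hs))
      (Ideal.span_mono (Set.singleton_subset_iff.2 hd))
  refine Int.natAbs_eq_of_dvd_dvd
    ((Submodule.IsPrincipal.mem_iff_generator_dvd _).1 (Ideal.subset_span hd))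
    (Ideal.mem_span_singleton.1 ?_)
  rw [← this]
  exact Submodule.IsPrincipal.generator_mem _

lemma eq_zero_of_setGcd_eq_zero {S : Set ℤ} (h : setGcd S = 0) {s : ℤ} (hs : s ∈ S) : s = 0 := by
  have h1 := (Submodule.IsPrincipal.mem_iff_generator_dvd _).1 (Ideal.subset_span hs)
  rw [setGcd, Int.natAbs_eq_zero] at h
  rw [h] at h1
  exact zero_dvd_iff.1 h1

/-- `A` maps lattice vectors to lattice vectors. -/
def IsIntegralMap (A : (Fin n → ℝ) →ₗ[ℝ] ℝ × ℝ) : Prop :=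
  ∀ x : Fin n → ℤ, ∃ d e : ℤ, A (latticePt x) = ((d : ℝ), (e : ℝ))

lemma IsIntegralMap.exists_det2 {A : (Fin n → ℝ) →ₗ[ℝ] ℝ × ℝ} (hA : IsIntegralMap A)
    (x y : Fin n → ℤ) : ∃ d : ℤ, (d : ℝ) = det2 (A (latticePt x)) (A (latticePt y)) := by
  obtain ⟨a, b, h⟩ := hA x
  obtain ⟨c, d, h'⟩ := hA y
  exact ⟨a * d - b * c, by rw [h, h']; simp [det2]⟩

/-- The index of the image under `A` of the lattice of a plane `P`. -/
noncomputable def areaIndex (A : (Fin n → ℝ) →ₗ[ℝ] ℝ × ℝ) (P : Submodule ℝ (Fin n → ℝ)) : ℕ :=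
  setGcd {d : ℤ | ∃ x y : Fin n → ℤ, latticePt x ∈ P ∧ latticePt y ∈ P ∧
    (d : ℝ) = det2 (A (latticePt x)) (A (latticePt y))}

/-- The vectors u, v form a lattice basis of ⟨σ⟩, so any other determinant is an integer multiple of
theirs. The index is thus computable from either ray although it depends only on the span. -/
lemma areaIndex_eq {A : (Fin n → ℝ) →ₗ[ℝ] ℝ × ℝ} (hA : IsIntegralMap A) {ρ σ : Cone n}
    {u v : Fin n → ℤ} (hρσ : ρ ≤ σ) (hu : IsPrimitiveGenerator ⊥ ρ u)
    (hv : IsPrimitiveGenerator ρ σ v) :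
    (areaIndex A (linSpan σ) : ℝ) = |det2 (A (latticePt u)) (A (latticePt v))| := by
  obtain ⟨d, hd⟩ := hA.exists_det2 u v
  rw [← hd, ← Int.cast_abs, ← Int.natCast_natAbs, Int.cast_natCast, Nat.cast_inj]
  refine setGcd_eq ⟨u, v, mem_linSpan (hρσ hu.1), mem_linSpan hv.1, hd⟩ ?_
  rintro s ⟨x, y, hx, hy, hs⟩
  obtain ⟨l, m, rfl⟩ := hu.exists_eq_add hv hx
  obtain ⟨l', m', rfl⟩ := hu.exists_eq_add hv hy
  refine ⟨l * m' - m * l', ?_⟩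
  have : (s : ℝ) = d * (l * m' - m * l') := by
    rw [hs, hd]
    simp only [latticePt_add, latticePt_smul, map_add, map_smul, det2_add_left, det2_add_right,
      det2_smul_left, det2_smul_right, det2_self, det2_swap (A (latticePt u)) (A (latticePt v))]
    ring
  exact_mod_cast this

lemma map_eq_top_of_areaIndex_ne_zero {A : (Fin n → ℝ) →ₗ[ℝ] ℝ × ℝ}
    {P : Submodule ℝ (Fin n → ℝ)} (h : areaIndex A P ≠ 0) : P.map A = ⊤ := by
  by_contra hP
  refine h ?_
  rw [areaIndex, setGcd_eq (d := 0)]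
  · rfl
  · exact ⟨0, 0, by simp, by simp, by simp⟩
  · rintro s ⟨x, y, hx, hy, hs⟩
    rw [det2_eq_zero_of_map_ne_top hP hx hy] at hs
    exact zero_dvd_iff.2 (by exact_mod_cast hs)

lemma areaIndex_ne_zero {A : (Fin n → ℝ) →ₗ[ℝ] ℝ × ℝ} (hA : IsIntegralMap A)
    {P : Submodule ℝ (Fin n → ℝ)} {x y : Fin n → ℤ} (hx : latticePt x ∈ P) (hy : latticePt y ∈ P)
    (h : det2 (A (latticePt x)) (A (latticePt y)) ≠ 0) : areaIndex A P ≠ 0 := by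
  intro h0
  obtain ⟨d, hd⟩ := hA.exists_det2 x y
  have := eq_zero_of_setGcd_eq_zero h0 ⟨x, y, hx, hy, hd⟩
  rw [this] at hd
  exact h (by rw [← hd]; simp)

end TropicalGallery

namespace TropicalGallery

variable {n : ℕ}

/-! ### The two rays of a plane cone -/

/-- Adding generators one at a time, keep the clockwise-most one; strong convexity prevents the
vectors from winding around the origin. -/
lemma exists_extremal_generator {C : Cone n} (hC : IsStronglyConvex C)
    {A : (Fin n → ℝ) →ₗ[ℝ] ℝ × ℝ} (hA : ∀ x ∈ linSpan C, A x = 0 → x = 0)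
    (S : Finset (Fin n → ℤ)) (hS : ∀ s ∈ S, latticePt s ∈ C ∧ s ≠ 0) (hne : S.Nonempty) :
    ∃ p ∈ S, ∀ s ∈ S, 0 ≤ det2 (A (latticePt p)) (A (latticePt s)) := by
  classical
  induction hne using Finset.Nonempty.cons_induction with
  | singleton a => exact ⟨a, by simp⟩
  | cons a S ha hne ih =>
    obtain ⟨p, hp, h⟩ := ih fun s hs => hS s (Finset.mem_cons_of_mem hs)
    rcases le_or_gt 0 (det2 (A (latticePt p)) (A (latticePt a))) with hpa | hpa
    · refine ⟨p, Finset.mem_cons_of_mem hp, fun s hs => ?_⟩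
      rcases Finset.mem_cons.1 hs with rfl | hs
      exacts [hpa, h s hs]
    · refine ⟨a, Finset.mem_cons_self _ _, fun s hs => ?_⟩
      rcases Finset.mem_cons.1 hs with rfl | hs
      · simp
      by_contra! hcon
      obtain ⟨hsC, hs0⟩ := hS s (Finset.mem_cons_of_mem hs)
      have haC := (hS a (Finset.mem_cons_self _ _)).1
      have hpC := (hS p (Finset.mem_cons_of_mem hp)).1
      rw [det2_swap] at hpa
      set α := det2 (A (latticePt a)) (A (latticePt p)) with hα
      set β := det2 (A (latticePt p)) (A (latticePt s)) with hβ
      set γ := det2 (A (latticePt a)) (A (latticePt s)) with hγ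
      -- Cramer's relation lifted from the plane. As α > 0, β ≥ 0 and γ < 0, it puts -s into `C`.
      have hrel : α • latticePt s + (β • latticePt a + (-γ) • latticePt p) = 0 := by
        refine hA _ (Submodule.add_mem _ (Submodule.smul_mem _ _ (mem_linSpan hsC))
          (Submodule.add_mem _ (Submodule.smul_mem _ _ (mem_linSpan haC))
            (Submodule.smul_mem _ _ (mem_linSpan hpC)))) ?_
        have := det2_smul_eq (A (latticePt a)) (A (latticePt p)) (A (latticePt s))
        rw [map_add, map_add, map_smul, map_smul, map_smul, hα, this, hβ, hγ,
          det2_swap (A (latticePt p)) (A (latticePt s))]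
        module
      have hα0 : 0 < α := by linarith
      have hmem : β • latticePt a + (-γ) • latticePt p ∈ C :=
        C.add_mem (PointedCone.smul_mem C (h s hs) haC) (PointedCone.smul_mem C (by linarith) hpC)
      refine hC _ hsC (fun h0 => hs0 (latticePt_injective (h0.trans latticePt_zero.symm))) ?_
      have : -latticePt s = α⁻¹ • (β • latticePt a + (-γ) • latticePt p) := by
        rw [eq_inv_smul_iff₀ hα0.ne', smul_neg]
        exact neg_eq_of_add_eq_zero_right hrel
      rw [this]
      exact PointedCone.smul_mem C (inv_nonneg.2 hα0.le) hmem

lemma exists_extremal {C : Cone n} (hr : IsRational C) (hC : IsStronglyConvex C)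
    {A : (Fin n → ℝ) →ₗ[ℝ] ℝ × ℝ} (hA : ∀ x ∈ linSpan C, A x = 0 → x = 0) (h0 : C ≠ ⊥) :
    ∃ p ∈ C, p ≠ 0 ∧ ∀ x ∈ C, 0 ≤ det2 (A p) (A x) := by
  classical
  obtain ⟨S, hS⟩ := hr
  have hSC : ∀ s ∈ S, latticePt s ∈ C := fun s hs => by
    rw [hS]; exact Submodule.subset_span ⟨s, hs, rfl⟩
  obtain ⟨p, hp, h⟩ := exists_extremal_generator hC hA (S.erase 0)
    (fun s hs => ⟨hSC s (Finset.mem_of_mem_erase hs), Finset.ne_of_mem_erase hs⟩) (by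
      by_contra hemp
      rw [Finset.not_nonempty_iff_eq_empty] at hemp
      refine h0 ?_
      rw [hS, Submodule.span_eq_bot]
      rintro _ ⟨s, hs, rfl⟩
      have hs0 : s = 0 := by
        by_contra hne
        have : s ∈ S.erase 0 := Finset.mem_erase.2 ⟨hne, hs⟩
        simp [hemp] at this
      rw [hs0, latticePt_zero])
  refine ⟨latticePt p, hSC p (Finset.mem_of_mem_erase hp), fun hp0 => Finset.ne_of_mem_erase hp
    (latticePt_injective (hp0.trans latticePt_zero.symm)), fun x hx => ?_⟩
  rw [hS] at hx
  induction hx using Submodule.span_induction with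
  | mem x hx =>
    obtain ⟨s, hs, rfl⟩ := hx
    by_cases hs0 : s = 0
    · simp [hs0]
    · exact h s (Finset.mem_erase.2 ⟨hs0, hs⟩)
  | zero => simp
  | add x y _ _ hx hy => rw [map_add, det2_add_right]; exact add_nonneg hx hy
  | smul t x _ hx =>
    have : A (t • x) = (t : ℝ) • A x := A.map_smul (t : ℝ) x
    rw [this, det2_smul_right]
    exact mul_nonneg t.2 hx

/-- The functional `det2 p`. -/
def det2Left (p : ℝ × ℝ) : ℝ × ℝ →ₗ[ℝ] ℝ :=
  p.1 • LinearMap.snd ℝ ℝ ℝ - p.2 • LinearMap.fst ℝ ℝ ℝ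

lemma det2Left_apply (p q : ℝ × ℝ) : det2Left p q = det2 p q := by
  simp [det2Left, det2]

lemma injOn_plane {σ : Cone n} {A : (Fin n → ℝ) →ₗ[ℝ] ℝ × ℝ} (hd : dim σ = 2)
    (h : (linSpan σ).map A = ⊤) {x y : Fin n → ℝ} (hx : x ∈ linSpan σ) (hy : y ∈ linSpan σ)
    (hxy : A x = A y) : x = y :=
  TropicalFan.injOn_of_map_linSpan_eq_top (by simp [hd]) h hx hy hxy

namespace Fan

/-- A side of a plane cone spans a ray of the fan. -/
lemma exists_ray_of_extremal (X : Fan n) {σ : Cone n} (hσ : σ ∈ X.conesOfDim 2)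
    {A : (Fin n → ℝ) →ₗ[ℝ] ℝ × ℝ} (hA : (linSpan σ).map A = ⊤) {p : Fin n → ℝ} (hp : p ∈ σ)
    (hp0 : p ≠ 0) {ε : ℝ} (hε : ε ≠ 0) (h : ∀ x ∈ σ, 0 ≤ ε * det2 (A p) (A x)) :
    ∃ ρ ∈ X.conesOfDim 1, ρ ≤ σ ∧ p ∈ ρ := by
  obtain ⟨hσ, hd⟩ := mem_conesOfDim.1 hσ
  set K : Submodule ℝ (Fin n → ℝ) := LinearMap.ker (det2Left (A p) ∘ₗ A) with hK
  have hKmem : ∀ x, x ∈ K ↔ det2 (A p) (A x) = 0 := fun x => by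
    rw [hK, LinearMap.mem_ker, LinearMap.comp_apply, det2Left_apply]
  have hmem : ∀ x, x ∈ σ ⊓ PointedCone.ofSubmodule K ↔ x ∈ σ ∧ det2 (A p) (A x) = 0 := fun x => by
    rw [Submodule.mem_inf, ← hKmem]; rfl
  -- The zero set of a linear form that is non-negative on `σ` is a face. The sign of `ε` lets one
  -- argument serve both sides of the cone.
  have hface : (σ ⊓ PointedCone.ofSubmodule K).IsFaceOf σ := by
    refine PointedCone.IsFaceOf.of_mem_of_add_mem_left inf_le_left fun {x y} hx hy hxy => ?_
    rw [hmem, map_add, det2_add_right] at hxy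
    refine (hmem _).2 ⟨hx, ?_⟩
    have h1 := h x hx
    have h2 := h y hy
    have h3 : ε * det2 (A p) (A x) = 0 := by
      have : ε * det2 (A p) (A x) + ε * det2 (A p) (A y) = 0 := by rw [← mul_add, hxy.2, mul_zero]
      linarith
    exact (mul_eq_zero.1 h3).resolve_left hε
  have hpρ : p ∈ σ ⊓ PointedCone.ofSubmodule K := (hmem p).2 ⟨hp, det2_self _⟩
  refine ⟨_, mem_conesOfDim.2 ⟨X.face_mem σ hσ _ hface, ?_⟩, inf_le_left, hpρ⟩
  have hAp : A p ≠ 0 := fun h0 => hp0 (injOn_plane hd hA (mem_linSpan hp) (Submodule.zero_mem _)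
    (h0.trans (map_zero A).symm))
  have : linSpan (σ ⊓ PointedCone.ofSubmodule K) = Submodule.span ℝ {p} := by
    refine le_antisymm (Submodule.span_le.2 fun x hx => ?_)
      ((Submodule.span_singleton_le_iff_mem _ _).2 (mem_linSpan hpρ))
    obtain ⟨hxσ, hx0⟩ := (hmem x).1 hx
    obtain ⟨c, hc⟩ := exists_smul_of_det2_eq_zero hAp hx0
    have : x = c • p := injOn_plane hd hA (mem_linSpan hxσ)
      (Submodule.smul_mem _ _ (mem_linSpan hp)) (by rw [hc, map_smul])
    rw [this]
    exact Submodule.smul_mem _ _ (Submodule.mem_span_singleton_self _)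
  rw [dim, this, finrank_span_singleton hp0]

end Fan

/-- The lattice vector generating a rational ray. -/
noncomputable def rayGen (ρ : Cone n) : Fin n → ℤ :=
  open Classical in if h : ∃ u, IsPrimitiveGenerator ⊥ ρ u then h.choose else 0

namespace Fan

variable {X : Fan n} {ρ : Cone n}

lemma isPrimitiveGenerator_rayGen (hρ : ρ ∈ X.conesOfDim 1) :
    IsPrimitiveGenerator ⊥ ρ (rayGen ρ) := by
  obtain ⟨hρ, hd⟩ := mem_conesOfDim.1 hρ
  have h := exists_isPrimitiveGenerator_bot (X.rational ρ hρ) hd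
  rw [rayGen, dif_pos h]
  exact h.choose_spec

lemma rayGen_mem (hρ : ρ ∈ X.conesOfDim 1) : latticePt (rayGen ρ) ∈ ρ :=
  (isPrimitiveGenerator_rayGen hρ).1

lemma rayGen_ne_zero (hρ : ρ ∈ X.conesOfDim 1) : latticePt (rayGen ρ) ≠ 0 :=
  (isPrimitiveGenerator_rayGen hρ).ne_zero (X.rational ρ (mem_conesOfDim.1 hρ).1)
    (mem_conesOfDim.1 hρ).2

lemma linSpan_ray (hρ : ρ ∈ X.conesOfDim 1) :
    linSpan ρ = Submodule.span ℝ {latticePt (rayGen ρ)} :=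
  (isPrimitiveGenerator_rayGen hρ).linSpan_eq (X.rational ρ (mem_conesOfDim.1 hρ).1)

lemma exists_eq_smul_rayGen (hρ : ρ ∈ X.conesOfDim 1) {x : Fin n → ℝ} (hx : x ∈ linSpan ρ) :
    ∃ c : ℝ, x = c • latticePt (rayGen ρ) := by
  rw [linSpan_ray hρ, Submodule.mem_span_singleton] at hx
  obtain ⟨c, rfl⟩ := hx
  exact ⟨c, rfl⟩

lemma exists_nonneg_smul_rayGen (hρ : ρ ∈ X.conesOfDim 1) {x : Fin n → ℝ} (hx : x ∈ ρ) :
    ∃ c : ℝ, 0 ≤ c ∧ x = c • latticePt (rayGen ρ) :=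
  (isPrimitiveGenerator_rayGen hρ).exists_nonneg_smul (X.rational ρ (mem_conesOfDim.1 hρ).1)
    (X.stronglyConvex ρ (mem_conesOfDim.1 hρ).1) (mem_conesOfDim.1 hρ).2 hx

lemma ray_eq_of_mem {ρ' : Cone n} (hρ : ρ ∈ X.conesOfDim 1) (hρ' : ρ' ∈ X.conesOfDim 1)
    {x : Fin n → ℝ} (hx : x ≠ 0) (h : x ∈ ρ) (h' : x ∈ ρ') : ρ = ρ' :=
  X.eq_of_mem_of_mem hρ hρ' h h' fun τ _ hd hxτ => hx (eq_zero_of_dim_eq_zero (by omega) hxτ)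

end Fan

/-- `ρ₁` and `ρ₂` are the rays of the plane cone `σ`, in the order given by the orientation which
`A` induces on the span of `σ`. -/
structure IsRayPair (X : Fan n) (A : (Fin n → ℝ) →ₗ[ℝ] ℝ × ℝ) (σ ρ₁ ρ₂ : Cone n) : Prop where
  mem : σ ∈ X.conesOfDim 2
  map_eq : (linSpan σ).map A = ⊤
  mem₁ : ρ₁ ∈ X.conesOfDim 1
  mem₂ : ρ₂ ∈ X.conesOfDim 1
  le₁ : ρ₁ ≤ σ
  le₂ : ρ₂ ≤ σ
  pos : 0 < det2 (A (latticePt (rayGen ρ₁))) (A (latticePt (rayGen ρ₂)))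
  nonneg₁ : ∀ x ∈ σ, 0 ≤ det2 (A (latticePt (rayGen ρ₁))) (A x)
  nonneg₂ : ∀ x ∈ σ, 0 ≤ det2 (A x) (A (latticePt (rayGen ρ₂)))

/-- `q` lies in the image of `σ`, but not on the last of its two sides in
counterclockwise order. -/
def InHalfOpen (A : (Fin n → ℝ) →ₗ[ℝ] ℝ × ℝ) (σ : Cone n) (q : ℝ × ℝ) : Prop :=
  (∃ x ∈ σ, A x = q) ∧ ∃ y ∈ σ, 0 < det2 q (A y)

lemma exists_isRayPair (X : Fan n) {A : (Fin n → ℝ) →ₗ[ℝ] ℝ × ℝ} {σ : Cone n}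
    (hσ : σ ∈ X.conesOfDim 2) (hA : (linSpan σ).map A = ⊤) : ∃ ρ₁ ρ₂, IsRayPair X A σ ρ₁ ρ₂ := by
  obtain ⟨hσX, hd⟩ := Fan.mem_conesOfDim.1 hσ
  have hinj : ∀ x ∈ linSpan σ, A x = 0 → x = 0 := fun x hx h =>
    injOn_plane hd hA hx (Submodule.zero_mem _) (h.trans (map_zero A).symm)
  have hbot : σ ≠ ⊥ := by rintro rfl; rw [dim_bot] at hd; omega
  obtain ⟨p, hp, hp0, hpx⟩ :=
    exists_extremal (X.rational σ hσX) (X.stronglyConvex σ hσX) hinj hbot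
  obtain ⟨r, hr, hr0, hrx⟩ : ∃ r ∈ σ, r ≠ 0 ∧ ∀ x ∈ σ, 0 ≤ det2 (A x) (A r) := by
    -- Swapping the coordinates reverses the orientation and yields the other extreme side.
    set A' := (LinearMap.snd ℝ ℝ ℝ ∘ₗ A).prod (LinearMap.fst ℝ ℝ ℝ ∘ₗ A) with hA'
    have hdet : ∀ x y, det2 (A' x) (A' y) = det2 (A y) (A x) := fun x y => by
      simp [hA', det2]; ring
    obtain ⟨r, hr, hr0, hrx⟩ :=
      exists_extremal (X.rational σ hσX) (X.stronglyConvex σ hσX) (A := A')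
        (fun x hx h => hinj x hx (by
          rw [Prod.ext_iff] at h ⊢; exact ⟨h.2, h.1⟩)) hbot
    exact ⟨r, hr, hr0, fun x hx => by rw [← hdet]; exact hrx x hx⟩
  have hAp : A p ≠ 0 := fun h => hp0 (hinj p (mem_linSpan hp) h)
  have hpr : 0 < det2 (A p) (A r) := by
    -- If the extreme vectors were parallel, r = c p: c < 0 contradicts strong convexity, and c > 0
    -- flattens the image of `σ` to a line, which misses the quarter turn of A p.
    refine lt_of_le_of_ne (hpx r hr) fun h0 => ?_
    obtain ⟨c, hc⟩ := exists_smul_of_det2_eq_zero hAp h0.symm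
    have hrc : r = c • p := injOn_plane hd hA (mem_linSpan hr)
      (Submodule.smul_mem _ _ (mem_linSpan hp)) (by rw [hc, map_smul])
    have hc0 : 0 < c := by
      by_contra hcon
      have hc' : c ≠ 0 := by rintro rfl; exact hr0 (by rw [hrc, zero_smul])
      have hneg : 0 < -c := by
        have := lt_of_le_of_ne (not_lt.1 hcon) hc'; linarith
      refine X.stronglyConvex σ hσX r hr hr0 ?_
      rw [hrc, ← neg_smul]
      exact PointedCone.smul_mem σ hneg.le hp
    have hzero : ∀ x ∈ σ, det2 (A p) (A x) = 0 := fun x hx => by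
      have h1 := hpx x hx
      have h2 := hrx x hx
      rw [hc, det2_smul_right, det2_swap] at h2
      nlinarith
    have hle : linSpan σ ≤ LinearMap.ker (det2Left (A p) ∘ₗ A) := Submodule.span_le.2 fun x hx => by
      simpa [det2Left_apply] using hzero x hx
    obtain ⟨y, hy, hyq⟩ : quarterTurn (A p) ∈ (linSpan σ).map A := hA ▸ Submodule.mem_top
    have := hle hy
    rw [LinearMap.mem_ker, LinearMap.comp_apply, det2Left_apply, hyq] at this
    exact (det2_quarterTurn_pos hAp).ne' this
  obtain ⟨ρ₁, h₁, hle₁, hp₁⟩ := X.exists_ray_of_extremal hσ hA hp hp0 one_ne_zero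
    (fun x hx => by rw [one_mul]; exact hpx x hx)
  obtain ⟨ρ₂, h₂, hle₂, hr₂⟩ := X.exists_ray_of_extremal hσ hA hr hr0 (neg_ne_zero.2 one_ne_zero)
    (fun x hx => by rw [neg_one_mul, ← det2_swap]; exact hrx x hx)
  obtain ⟨c₁, hc₁, e₁⟩ := Fan.exists_nonneg_smul_rayGen h₁ hp₁
  obtain ⟨c₂, hc₂, e₂⟩ := Fan.exists_nonneg_smul_rayGen h₂ hr₂
  have hc₁' : 0 < c₁ := lt_of_le_of_ne hc₁ fun h => hp0 (by rw [e₁, ← h, zero_smul])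
  have hc₂' : 0 < c₂ := lt_of_le_of_ne hc₂ fun h => hr0 (by rw [e₂, ← h, zero_smul])
  rw [e₁, e₂, map_smul, map_smul, det2_smul_left, det2_smul_right] at hpr
  refine ⟨ρ₁, ρ₂, hσ, hA, h₁, h₂, hle₁, hle₂, ?_, fun x hx => ?_, fun x hx => ?_⟩
  · exact pos_of_mul_pos_right (pos_of_mul_pos_right hpr hc₁) hc₂
  · have := hpx x hx
    rw [e₁, map_smul, det2_smul_left] at this
    exact nonneg_of_mul_nonneg_right this hc₁'
  · have := hrx x hx
    rw [e₂, map_smul, det2_smul_right] at this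
    exact nonneg_of_mul_nonneg_right this hc₂'

namespace IsRayPair

variable {X : Fan n} {A : (Fin n → ℝ) →ₗ[ℝ] ℝ × ℝ} {σ ρ₁ ρ₂ : Cone n}

lemma eq_add (h : IsRayPair X A σ ρ₁ ρ₂) {x : Fin n → ℝ} (hx : x ∈ linSpan σ) :
    x = (det2 (A x) (A (latticePt (rayGen ρ₂))) /
          det2 (A (latticePt (rayGen ρ₁))) (A (latticePt (rayGen ρ₂)))) • latticePt (rayGen ρ₁) +
        (det2 (A (latticePt (rayGen ρ₁))) (A x) /
          det2 (A (latticePt (rayGen ρ₁))) (A (latticePt (rayGen ρ₂)))) • latticePt (rayGen ρ₂) := by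
  refine injOn_plane (Fan.mem_conesOfDim.1 h.mem).2 h.map_eq hx (Submodule.add_mem _
    (Submodule.smul_mem _ _ (mem_linSpan (h.le₁ (Fan.rayGen_mem h.mem₁))))
    (Submodule.smul_mem _ _ (mem_linSpan (h.le₂ (Fan.rayGen_mem h.mem₂))))) ?_
  rw [map_add, map_smul, map_smul]
  exact eq_smul_add_smul_of_det2_ne_zero h.pos.ne' _

lemma exists_eq_add (h : IsRayPair X A σ ρ₁ ρ₂) {x : Fin n → ℝ} (hx : x ∈ σ) :
    ∃ α β : ℝ, 0 ≤ α ∧ 0 ≤ β ∧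
      x = α • latticePt (rayGen ρ₁) + β • latticePt (rayGen ρ₂) :=
  ⟨_, _, div_nonneg (h.nonneg₂ x hx) h.pos.le, div_nonneg (h.nonneg₁ x hx) h.pos.le,
    h.eq_add (mem_linSpan hx)⟩

lemma ne (h : IsRayPair X A σ ρ₁ ρ₂) : ρ₁ ≠ ρ₂ := by
  rintro rfl
  simpa using h.pos

/-- Write the generator of `ρ` as α u₁ + β u₂. If α > 0, the face property puts u₁ into `ρ`;
otherwise it is a multiple of u₂. -/
lemma eq_or_eq (h : IsRayPair X A σ ρ₁ ρ₂) {ρ : Cone n} (hρ : ρ ∈ X.conesOfDim 1) (hle : ρ ≤ σ) :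
    ρ = ρ₁ ∨ ρ = ρ₂ := by
  have hface := X.isFaceOf_of_le (Fan.mem_conesOfDim.1 hρ).1 (Fan.mem_conesOfDim.1 h.mem).1 hle
  have hu := Fan.rayGen_mem hρ
  obtain ⟨α, β, hα, hβ, e⟩ := h.exists_eq_add (hle hu)
  have m₁ := h.le₁ (Fan.rayGen_mem h.mem₁)
  have m₂ := h.le₂ (Fan.rayGen_mem h.mem₂)
  rcases hα.eq_or_lt with h0 | hpos
  · right
    rw [← h0, zero_smul, zero_add] at e
    have hβ0 : β ≠ 0 := by rintro rfl; exact Fan.rayGen_ne_zero hρ (by rw [e, zero_smul])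
    refine Fan.ray_eq_of_mem hρ h.mem₂ (Fan.rayGen_ne_zero hρ) hu ?_
    rw [e]
    exact PointedCone.smul_mem _ hβ (Fan.rayGen_mem h.mem₂)
  · left
    refine Fan.ray_eq_of_mem hρ h.mem₁ (Fan.rayGen_ne_zero h.mem₁) ?_ (Fan.rayGen_mem h.mem₁)
    refine hface.mem_of_smul_add_mem m₁ (PointedCone.smul_mem σ hβ m₂) hpos ?_
    rw [← e]
    exact hu

lemma inHalfOpen_iff (h : IsRayPair X A σ ρ₁ ρ₂) (q : ℝ × ℝ) :
    InHalfOpen A σ q ↔ 0 ≤ det2 (A (latticePt (rayGen ρ₁))) q ∧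
      0 < det2 q (A (latticePt (rayGen ρ₂))) := by
  have m₁ := h.le₁ (Fan.rayGen_mem h.mem₁)
  have m₂ := h.le₂ (Fan.rayGen_mem h.mem₂)
  constructor
  · rintro ⟨⟨x, hx, rfl⟩, y, hy, hxy⟩
    refine ⟨h.nonneg₁ x hx, lt_of_le_of_ne (h.nonneg₂ x hx) fun h0 => ?_⟩
    have e := h.eq_add (mem_linSpan hx)
    -- Here x lies on the last side, and no point of `σ` is counterclockwise of it.
    rw [← h0, zero_div, zero_smul, zero_add] at e
    rw [e, map_smul, det2_smul_left, det2_swap (A y)] at hxy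
    have h1 := h.nonneg₂ y hy
    have h2 := div_nonneg (h.nonneg₁ x hx) h.pos.le
    nlinarith
  · rintro ⟨h1, h2⟩
    refine ⟨⟨(det2 q (A (latticePt (rayGen ρ₂))) /
          det2 (A (latticePt (rayGen ρ₁))) (A (latticePt (rayGen ρ₂)))) • latticePt (rayGen ρ₁) +
        (det2 (A (latticePt (rayGen ρ₁))) q /
          det2 (A (latticePt (rayGen ρ₁))) (A (latticePt (rayGen ρ₂)))) • latticePt (rayGen ρ₂),
      σ.add_mem (PointedCone.smul_mem σ (div_nonneg h2.le h.pos.le) m₁)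
        (PointedCone.smul_mem σ (div_nonneg h1 h.pos.le) m₂), ?_⟩, _, m₂, h2⟩
    rw [map_add, map_smul, map_smul, ← eq_smul_add_smul_of_det2_ne_zero h.pos.ne']

lemma areaIndex_pos (h : IsRayPair X A σ ρ₁ ρ₂) (hA : IsIntegralMap A) :
    0 < areaIndex A (linSpan σ) :=
  Nat.pos_of_ne_zero (areaIndex_ne_zero hA (mem_linSpan (h.le₁ (Fan.rayGen_mem h.mem₁)))
    (mem_linSpan (h.le₂ (Fan.rayGen_mem h.mem₂))) h.pos.ne')

/-- The sign, opposite in `det2_second`, records on which side of the cone the ray lies; the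
projected balancing sums therefore compare facets leaving a ray with facets arriving at it. -/
lemma det2_first (h : IsRayPair X A σ ρ₁ ρ₂) (hA : IsIntegralMap A) {v : Fin n → ℤ}
    (hv : IsPrimitiveGenerator ρ₁ σ v) :
    det2 (A (latticePt (rayGen ρ₁))) (A (latticePt v)) = areaIndex A (linSpan σ) := by
  rw [areaIndex_eq hA h.le₁ (Fan.isPrimitiveGenerator_rayGen h.mem₁) hv,
    abs_of_nonneg (h.nonneg₁ _ hv.1)]

lemma det2_second (h : IsRayPair X A σ ρ₁ ρ₂) (hA : IsIntegralMap A) {v : Fin n → ℤ}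
    (hv : IsPrimitiveGenerator ρ₂ σ v) :
    det2 (A (latticePt (rayGen ρ₂))) (A (latticePt v)) = -areaIndex A (linSpan σ) := by
  have h0 := h.nonneg₂ _ hv.1
  rw [areaIndex_eq hA h.le₂ (Fan.isPrimitiveGenerator_rayGen h.mem₂) hv,
    abs_of_nonpos (by rw [det2_swap]; linarith), neg_neg]

end IsRayPair

end TropicalGallery

namespace TropicalGallery

variable {n : ℕ}

/-! ### The degree over a direction of the plane -/

open Classical in
/-- The weighted number of plane cones whose half-open image contains `q`. -/
noncomputable def halfOpenDegree (X : Fan n) (A : (Fin n → ℝ) →ₗ[ℝ] ℝ × ℝ) (w : Cone n → ℝ)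
    (q : ℝ × ℝ) : ℝ :=
  ∑ σ ∈ X.conesOfDim 2, w σ * if InHalfOpen A σ q then (areaIndex A (linSpan σ) : ℝ) else 0

lemma IsNormalSystem.isPrimitiveGenerator {X : Fan n} {v : Cone n → Cone n → Fin n → ℤ}
    (hv : IsNormalSystem X 2 v) {ρ σ : Cone n} (hρ : ρ ∈ X.conesOfDim 1) (hσ : σ ∈ X.conesOfDim 2)
    (h : ρ ≤ σ) : IsPrimitiveGenerator ρ σ (v ρ σ) := by
  rw [Fan.mem_conesOfDim] at hρ hσ
  exact hv ρ hρ.1 (by omega) σ (Fan.mem_above.2 ⟨hσ, h⟩)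

namespace Fan

open Classical in
lemma sum_rays_comm (X : Fan n) (f : Cone n → Cone n → ℝ) :
    ∑ ρ ∈ X.conesOfDim 1, ∑ σ ∈ X.above 2 ρ, f ρ σ =
      ∑ σ ∈ X.conesOfDim 2, ∑ ρ ∈ (X.conesOfDim 1).filter (· ≤ σ), f ρ σ := by
  refine Finset.sum_comm' fun ρ σ => ?_
  simp only [mem_above, Finset.mem_filter, mem_conesOfDim]
  tauto

end Fan

open Classical in
lemma IsRayPair.sum_rays {X : Fan n} {A : (Fin n → ℝ) →ₗ[ℝ] ℝ × ℝ} {σ ρ₁ ρ₂ : Cone n}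
    (h : IsRayPair X A σ ρ₁ ρ₂) (f : Cone n → ℝ) :
    ∑ ρ ∈ (X.conesOfDim 1).filter (· ≤ σ), f ρ = f ρ₁ + f ρ₂ := by
  have : (X.conesOfDim 1).filter (· ≤ σ) = {ρ₁, ρ₂} := by
    ext ρ
    simp only [Finset.mem_filter, Finset.mem_insert, Finset.mem_singleton]
    constructor
    · rintro ⟨hρ, hle⟩
      exact h.eq_or_eq hρ hle
    · rintro (rfl | rfl)
      exacts [⟨h.mem₁, h.le₁⟩, ⟨h.mem₂, h.le₂⟩]
  rw [this, Finset.sum_pair h.ne]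

lemma areaIndex_eq_zero {A : (Fin n → ℝ) →ₗ[ℝ] ℝ × ℝ} {P : Submodule ℝ (Fin n → ℝ)}
    (h : P.map A ≠ ⊤) : areaIndex A P = 0 := by
  by_contra h0
  exact h (map_eq_top_of_areaIndex_ne_zero h0)

/-- Turning q to q' gains the cones whose first ray is passed and loses those whose last ray is
passed. Regrouped by rays, the change is a combination of the sums in `hw`. Only this projected
balancing is required of `w`, so that it also applies to part of a gallery. -/
lemma halfOpenDegree_eq_of_det2_pos {X : Fan n} {A : (Fin n → ℝ) →ₗ[ℝ] ℝ × ℝ}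
    (hA : IsIntegralMap A) {v : Cone n → Cone n → Fin n → ℤ} (hv : IsNormalSystem X 2 v)
    {w : Cone n → ℝ}
    (hw : ∀ ρ ∈ X.conesOfDim 1, ∑ σ ∈ X.above 2 ρ,
      w σ * det2 (A (latticePt (rayGen ρ))) (A (latticePt (v ρ σ))) = 0)
    {q q' : ℝ × ℝ} (hq : 0 < det2 q q') : halfOpenDegree X A w q = halfOpenDegree X A w q' := by
  classical
  -- Indicator of the rays passed: those with image in the angle from q, excluded, to q', included.
  set g : Cone n → ℝ := fun ρ => if 0 < det2 q (A (latticePt (rayGen ρ))) ∧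
    0 ≤ det2 (A (latticePt (rayGen ρ))) q' then 1 else 0 with hg
  have key : ∀ σ ∈ X.conesOfDim 2,
      (w σ * if InHalfOpen A σ q then (areaIndex A (linSpan σ) : ℝ) else 0) -
        (w σ * if InHalfOpen A σ q' then (areaIndex A (linSpan σ) : ℝ) else 0) =
      -∑ ρ ∈ (X.conesOfDim 1).filter (· ≤ σ),
        g ρ * (w σ * det2 (A (latticePt (rayGen ρ))) (A (latticePt (v ρ σ)))) := by
    intro σ hσ
    by_cases htop : (linSpan σ).map A = ⊤
    · obtain ⟨ρ₁, ρ₂, h⟩ := exists_isRayPair X hσ htop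
      rw [h.sum_rays, h.det2_first hA (hv.isPrimitiveGenerator h.mem₁ hσ h.le₁),
        h.det2_second hA (hv.isPrimitiveGenerator h.mem₂ hσ h.le₂),
        if_congr (h.inHalfOpen_iff q) rfl rfl, if_congr (h.inHalfOpen_iff q') rfl rfl,
        ← mul_boole, ← mul_boole _ (areaIndex A (linSpan σ) : ℝ)]
      have := indicator_angle_sub h.pos hq
      linear_combination (w σ * (areaIndex A (linSpan σ) : ℝ)) * this
    · rw [areaIndex_eq_zero htop, Finset.sum_eq_zero]
      · simp
      · intro ρ hρ
        obtain ⟨hρ, hle⟩ := Finset.mem_filter.1 hρ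
        rw [det2_eq_zero_of_map_ne_top htop (mem_linSpan (hle (Fan.rayGen_mem hρ)))
          (mem_linSpan (hv.isPrimitiveGenerator hρ hσ hle).1), mul_zero, mul_zero]
  rw [← sub_eq_zero, halfOpenDegree, halfOpenDegree, ← Finset.sum_sub_distrib,
    Finset.sum_congr rfl key, Finset.sum_neg_distrib, ← X.sum_rays_comm, neg_eq_zero]
  refine Finset.sum_eq_zero fun ρ hρ => ?_
  rw [← Finset.mul_sum, hw ρ hρ, mul_zero]

lemma halfOpenDegree_eq {X : Fan n} {A : (Fin n → ℝ) →ₗ[ℝ] ℝ × ℝ}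
    (hA : IsIntegralMap A) {v : Cone n → Cone n → Fin n → ℤ} (hv : IsNormalSystem X 2 v)
    {w : Cone n → ℝ}
    (hw : ∀ ρ ∈ X.conesOfDim 1, ∑ σ ∈ X.above 2 ρ,
      w σ * det2 (A (latticePt (rayGen ρ))) (A (latticePt (v ρ σ))) = 0)
    {q q' : ℝ × ℝ} (hq : q ≠ 0) (hq' : q' ≠ 0) :
    halfOpenDegree X A w q = halfOpenDegree X A w q' := by
  have aux : ∀ {r s : ℝ × ℝ}, det2 r s ≠ 0 → halfOpenDegree X A w r = halfOpenDegree X A w s := by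
    intro r s h
    rcases h.lt_or_gt with h | h
    · exact (halfOpenDegree_eq_of_det2_pos hA hv hw (by rw [det2_swap]; linarith)).symm
    · exact halfOpenDegree_eq_of_det2_pos hA hv hw h
  by_cases h : det2 q q' = 0
  -- Parallel directions are compared through a perpendicular one.
  · have h1 := det2_quarterTurn_pos hq
    obtain ⟨c, rfl⟩ := exists_smul_of_det2_eq_zero hq h
    have hc : c ≠ 0 := by rintro rfl; simp at hq'
    refine (aux h1.ne').trans (aux ?_)
    rw [det2_smul_right, det2_swap q]
    exact mul_ne_zero hc (by linarith)
  · exact aux h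

namespace TropicalFan

variable {X : TropicalFan n 2} {A : (Fin n → ℝ) →ₗ[ℝ] ℝ × ℝ}

/-- The balancing sum is a multiple of the generator of `ρ`, on which the determinant with that
generator vanishes. -/
lemma sum_above_eq_zero (X : TropicalFan n 2) (A : (Fin n → ℝ) →ₗ[ℝ] ℝ × ℝ)
    {v : Cone n → Cone n → Fin n → ℤ} (hv : IsNormalSystem X.toFan 2 v) {ρ : Cone n}
    (hρ : ρ ∈ X.conesOfDim 1) :
    ∑ σ ∈ X.above 2 ρ, (X.weight σ : ℝ) *
      det2 (A (latticePt (rayGen ρ))) (A (latticePt (v ρ σ))) = 0 := by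
  obtain ⟨hρX, hd⟩ := Fan.mem_conesOfDim.1 hρ
  obtain ⟨c, hc⟩ := Fan.exists_eq_smul_rayGen hρ (X.balanced.sum_mem hv hρX (by omega))
  have : det2 (A (latticePt (rayGen ρ)))
      (A (∑ σ ∈ X.above 2 ρ, (X.weight σ : ℝ) • latticePt (v ρ σ))) = 0 := by
    rw [hc, map_smul, det2_smul_right, det2_self, mul_zero]
  rw [map_sum, det2_sum_right] at this
  simpa only [map_smul, det2_smul_right] using this

/-- The degree of a tropical fan of dimension `2` over the plane. -/
noncomputable def degree (X : TropicalFan n 2) (A : (Fin n → ℝ) →ₗ[ℝ] ℝ × ℝ) (q : ℝ × ℝ) : ℝ :=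
  halfOpenDegree X.toFan A (fun σ => X.weight σ) q

lemma degree_eq (X : TropicalFan n 2) (hA : IsIntegralMap A) {q q' : ℝ × ℝ} (hq : q ≠ 0)
    (hq' : q' ≠ 0) : X.degree A q = X.degree A q' := by
  obtain ⟨v, hv, -⟩ := X.balanced
  exact halfOpenDegree_eq hA hv (fun ρ hρ => X.sum_above_eq_zero A hv hρ) hq hq'

/-- A point lost by the half-open convention lies in the image of the span of a ray, which the
choice of q excludes. -/
lemma degree_eq_fibreDegree (X : TropicalFan n 2) {q : ℝ × ℝ}
    (hq : ∀ τ ∈ X.cones, (linSpan τ).map A ≠ ⊤ → q ∉ (linSpan τ).map A) :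
    X.degree A q = X.fibreDegree A q (fun P => areaIndex A P) := by
  classical
  refine Finset.sum_congr rfl fun σ hσ => ?_
  by_cases htop : (linSpan σ).map A = ⊤
  · obtain ⟨ρ₁, ρ₂, h⟩ := exists_isRayPair X.toFan hσ htop
    have hiff : InHalfOpen A σ q ↔ ∃ x ∈ σ, A x = q := by
      refine ⟨fun h => h.1, ?_⟩
      rintro ⟨x, hx, rfl⟩
      refine ⟨⟨x, hx, rfl⟩, _, h.le₂ (Fan.rayGen_mem h.mem₂),
        lt_of_le_of_ne (h.nonneg₂ x hx) fun h0 => ?_⟩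
      obtain ⟨hρ, hd⟩ := Fan.mem_conesOfDim.1 h.mem₂
      refine hq ρ₂ hρ (fun ht => ?_) ?_
      · have := Submodule.finrank_map_le A (linSpan ρ₂)
        rw [ht, finrank_top, Module.finrank_prod, Module.finrank_self] at this
        rw [dim] at hd
        omega
      · have e := h.eq_add (mem_linSpan hx)
        rw [← h0, zero_div, zero_smul, zero_add] at e
        refine ⟨x, ?_, rfl⟩
        rw [e]
        exact Submodule.smul_mem _ _ (mem_linSpan (Fan.rayGen_mem h.mem₂))
    simp only [hiff, mul_ite, mul_zero]
  · simp [areaIndex_eq_zero htop]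

/-- Both degrees may be moved to a common generic point, where they are fibre degrees. -/
lemma Equivalent.degree_eq {Y : TropicalFan n 2} (h : X.Equivalent Y) (hA : IsIntegralMap A)
    {q q' : ℝ × ℝ} (hq : q ≠ 0) (hq' : q' ≠ 0) : X.degree A q = Y.degree A q' := by
  classical
  obtain ⟨p, hp, hf⟩ := h.exists_fibreDegree_eq A (by simp)
  have hp0 : p ≠ 0 := by
    rintro rfl
    refine hp ⊥ (Finset.mem_union_left _ X.bot_mem) ?_ (Submodule.zero_mem _)
    rw [linSpan_bot, Submodule.map_bot]
    exact bot_ne_top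
  rw [X.degree_eq hA hq hp0, Y.degree_eq hA hq' hp0,
    X.degree_eq_fibreDegree fun τ hτ => hp τ (Finset.mem_union_left _ hτ),
    Y.degree_eq_fibreDegree fun τ hτ => hp τ (Finset.mem_union_right _ hτ), hf]

end TropicalFan

end TropicalGallery

namespace TropicalGallery

variable {n : ℕ}

/-! ### Intersection products with tropical binomials -/

/-- The index of the image under `a` of the lattice of a line `P`. -/
noncomputable def heightIndex (a : (Fin n → ℝ) →ₗ[ℝ] ℝ) (P : Submodule ℝ (Fin n → ℝ)) : ℕ :=
  setGcd {d : ℤ | ∃ x : Fin n → ℤ, latticePt x ∈ P ∧ (d : ℝ) = a (latticePt x)}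

open Classical in
-- Turns the terms of a product with a binomial into fibre contributions over 1, which are invariant
-- under refinement.
lemma ite_heightIndex_eq {X : Fan n} {a : (Fin n → ℝ) →ₗ[ℝ] ℝ}
    (ha : ∀ x : Fin n → ℤ, ∃ d : ℤ, (d : ℝ) = a (latticePt x)) {ρ : Cone n}
    (hρ : ρ ∈ X.conesOfDim 1) {u : Fin n → ℤ} (hu : IsPrimitiveGenerator ⊥ ρ u) :
    (if ∃ x ∈ ρ, a x = 1 then (heightIndex a (linSpan ρ) : ℝ) else 0) =
      max 0 (a (latticePt u)) := by
  obtain ⟨hρX, hd⟩ := Fan.mem_conesOfDim.1 hρ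
  have hiff : (∃ x ∈ ρ, a x = 1) ↔ 0 < a (latticePt u) := by
    constructor
    · rintro ⟨x, hx, h1⟩
      obtain ⟨c, hc, rfl⟩ :=
        hu.exists_nonneg_smul (X.rational ρ hρX) (X.stronglyConvex ρ hρX) hd hx
      rw [map_smul, smul_eq_mul] at h1
      exact pos_of_mul_pos_right (h1 ▸ one_pos) hc
    · intro h
      refine ⟨(a (latticePt u))⁻¹ • latticePt u,
        PointedCone.smul_mem ρ (inv_nonneg.2 h.le) hu.1, ?_⟩
      rw [map_smul, smul_eq_mul, inv_mul_cancel₀ h.ne']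
  simp only [hiff]
  split_ifs with h
  · obtain ⟨d, hdu⟩ := ha u
    have : heightIndex a (linSpan ρ) = d.natAbs := by
      refine setGcd_eq ⟨u, mem_linSpan hu.1, hdu⟩ ?_
      rintro s ⟨x, hx, hs⟩
      obtain ⟨m, rfl⟩ := hu.exists_eq_smul hx
      refine ⟨m, ?_⟩
      rw [latticePt_smul, map_smul, smul_eq_mul, ← hdu, mul_comm] at hs
      exact_mod_cast hs
    rw [max_eq_right h.le, this, ← hdu, ← Int.cast_natCast, Int.natCast_natAbs, Int.cast_abs, hdu,
      abs_of_pos h]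
  · rw [max_eq_left (not_lt.1 h)]

lemma exists_intCast_eq_intFunctional (l x : Fin n → ℤ) :
    ∃ d : ℤ, (d : ℝ) = intFunctional l (latticePt x) :=
  ⟨∑ i, l i * x i, by simp [intFunctional, latticePt]⟩

lemma linearPart_apply {T : (Fin n → ℝ) → ℝ} {σ : Cone n} (h : IsLinearOn T σ) {x : Fin n → ℝ}
    (hx : x ∈ σ) : linearPart T σ x = T x := by
  rw [linearPart, dif_pos h]
  exact h.choose_spec x hx

namespace TropicalBinomial

/-- The functional `l - h`. -/
noncomputable def diff (L : TropicalBinomial n) : (Fin n → ℝ) →ₗ[ℝ] ℝ :=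
  intFunctional L.l - intFunctional L.h

/-- The linear summand `h` contributes nothing to products, by balancing. -/
lemma toFun_eq (L : TropicalBinomial n) (x : Fin n → ℝ) :
    L.toFun x = intFunctional L.h x + max 0 (L.diff x) := by
  rw [toFun, diff, LinearMap.sub_apply, ← max_add_add_left, add_zero, add_sub_cancel, max_comm]

lemma exists_intCast_eq_diff (L : TropicalBinomial n) (x : Fin n → ℤ) :
    ∃ d : ℤ, (d : ℝ) = L.diff (latticePt x) := by
  obtain ⟨d, hd⟩ := exists_intCast_eq_intFunctional L.l x
  obtain ⟨e, he⟩ := exists_intCast_eq_intFunctional L.h x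
  exact ⟨d - e, by rw [Int.cast_sub, hd, he]; rfl⟩

/-- A function max(0, d) that is linear on a cone forbids d to change sign there. -/
lemma diff_nonneg_of_pos {L : TropicalBinomial n} {σ : Cone n} (h : IsLinearOn L.toFun σ)
    {x y : Fin n → ℝ} (hx : x ∈ σ) (hy : y ∈ σ) (hpos : 0 < L.diff x) : 0 ≤ L.diff y := by
  obtain ⟨f, hf⟩ := h
  have h1 := hf x hx
  have h2 := hf y hy
  have h3 := hf (x + y) (σ.add_mem hx hy)
  rw [map_add, h1, h2, toFun_eq, toFun_eq, toFun_eq, map_add, map_add, max_eq_right hpos.le] at h3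
  by_contra! hneg
  rw [max_eq_left hneg.le] at h3
  rcases max_choice 0 (L.diff x + L.diff y) with h | h <;> rw [h] at h3 <;> linarith

end TropicalBinomial

open Classical in
/-- The weights of the product of a tropical binomial with a fan of dimension `2`. -/
lemma IsFanProduct.weight_eq {L : TropicalBinomial n} {X : TropicalFan n 2} {Y : TropicalFan n 1}
    (h : IsFanProduct L.toFun X Y) : ∃ v, IsNormalSystem X.toFan 2 v ∧ ∀ ρ ∈ X.conesOfDim 1,
      (Y.weight ρ : ℝ) = if L.diff (latticePt (rayGen ρ)) = 0 then
        ∑ σ ∈ X.above 2 ρ, (X.weight σ : ℝ) * max 0 (L.diff (latticePt (v ρ σ))) else 0 := by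
  obtain ⟨hlin, hcones, v, hv, hw⟩ := h
  refine ⟨v, hv, fun ρ hρ => ?_⟩
  obtain ⟨hρX, hd⟩ := Fan.mem_conesOfDim.1 hρ
  have hu := Fan.rayGen_mem hρ
  obtain ⟨c, hc⟩ := Fan.exists_eq_smul_rayGen hρ (X.balanced.sum_mem hv hρX (by omega))
  have hσ : ∀ σ ∈ X.above 2 ρ, latticePt (v ρ σ) ∈ σ ∧ latticePt (rayGen ρ) ∈ σ ∧
      IsLinearOn L.toFun σ := fun σ hσ =>
    ⟨(hv ρ hρX (by omega) σ hσ).1, (Fan.mem_above.1 hσ).2 hu, hlin σ (Fan.mem_above.1 hσ).1.1⟩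
  have hsum : ∀ f : (Fin n → ℝ) →ₗ[ℝ] ℝ,
      ∑ σ ∈ X.above 2 ρ, (X.weight σ : ℝ) * f (latticePt (v ρ σ)) =
        c * f (latticePt (rayGen ρ)) := fun f => by
    rw [← smul_eq_mul c, ← map_smul, ← hc, map_sum]
    exact Finset.sum_congr rfl fun σ _ => (map_smul f _ _).symm
  have hmain : (Y.weight ρ : ℝ) =
      ∑ σ ∈ X.above 2 ρ, (X.weight σ : ℝ) * max 0 (L.diff (latticePt (v ρ σ))) -
        c * max 0 (L.diff (latticePt (rayGen ρ))) := by
    rw [hw ρ (Fan.mem_conesOfDim.2 ⟨(hcones ρ).2 ⟨hρX, hd.le⟩, hd⟩), hc, map_smul,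
      linearPart_apply (hlin ρ hρX) hu, L.toFun_eq, smul_add, smul_eq_mul, smul_eq_mul,
      ← hsum (intFunctional L.h), ← sub_sub, ← Finset.sum_sub_distrib]
    congr 1
    refine Finset.sum_congr rfl fun σ hσ' => ?_
    rw [map_smul, linearPart_apply (hσ σ hσ').2.2 (hσ σ hσ').1, L.toFun_eq, smul_eq_mul]
    ring
  rw [hmain]
  -- Off the hypersurface the binomial is one linear function on all cones around `ρ`, so the weight
  -- vanishes.
  rcases lt_trichotomy (L.diff (latticePt (rayGen ρ))) 0 with hneg | h0 | hpos
  · rw [if_neg hneg.ne, max_eq_left hneg.le, mul_zero, sub_zero]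
    refine Finset.sum_eq_zero fun σ hσ' => ?_
    obtain ⟨h1, h2, h3⟩ := hσ σ hσ'
    rw [max_eq_left, mul_zero]
    by_contra! hcon
    exact hneg.not_ge (TropicalBinomial.diff_nonneg_of_pos h3 h1 h2 hcon)
  · rw [if_pos h0, h0, max_self, mul_zero, sub_zero]
  · rw [if_neg hpos.ne', max_eq_right hpos.le, ← hsum L.diff, sub_eq_zero]
    refine Finset.sum_congr rfl fun σ hσ' => ?_
    obtain ⟨h1, h2, h3⟩ := hσ σ hσ'
    rw [max_eq_right (TropicalBinomial.diff_nonneg_of_pos h3 h2 h1 hpos)]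

/-! ### The multiplicity of the origin as a degree -/

namespace TropicalFan

lemma facets_zero (Z : TropicalFan n 0) : Z.facets = {⊥} := by
  ext σ
  rw [mem_facets, Finset.mem_singleton]
  constructor
  · exact fun h => eq_bot_of_dim_eq_zero h.2
  · rintro rfl
    exact ⟨Z.bot_mem, dim_bot⟩

lemma Equivalent.weight_bot_eq {Z Z' : TropicalFan n 0} (h : Z.Equivalent Z') :
    Z.weight ⊥ = Z'.weight ⊥ := by
  have := h.fibreDegree_eq_of_le_one (V := Fin 0 → ℝ) (A := 0) (q := 0) (by simp) (by simp)
    (by simp) (fun _ => 1)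
  have hx : ∃ x : Fin n → ℝ, x = 0 := ⟨0, rfl⟩
  simpa [fibreDegree, facets_zero, hx] using this

end TropicalFan

lemma IsFanProduct.weight_bot_eq {L : TropicalBinomial n} {Y : TropicalFan n 1}
    {Z : TropicalFan n 0} (h : IsFanProduct L.toFun Y Z) :
    (Z.weight ⊥ : ℝ) = Y.fibreDegree L.diff 1 (fun P => heightIndex L.diff P) := by
  classical
  obtain ⟨hlin, hcones, v, hv, hw⟩ := h
  have habove : Y.above 1 ⊥ = Y.facets := by
    ext σ
    rw [Fan.mem_above, TropicalFan.mem_facets]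
    exact and_iff_left bot_le
  have hb := Y.balanced.sum_mem hv Y.bot_mem (by rw [dim_bot])
  have hb0 : ∑ σ ∈ Y.above 1 ⊥, (Y.weight σ : ℝ) • latticePt (v ⊥ σ) = 0 := by
    simpa [linSpan_bot] using hb
  have hh : ∑ σ ∈ Y.above 1 ⊥, (Y.weight σ : ℝ) * intFunctional L.h (latticePt (v ⊥ σ)) = 0 := by
    have := congrArg (intFunctional L.h) hb0
    simpa [map_sum] using this
  rw [hw ⊥ (by simp [TropicalFan.facets_zero])]
  simp only [zero_add]
  rw [hb0, map_zero, sub_zero, TropicalFan.fibreDegree, ← habove]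
  refine sub_eq_zero.1 (Eq.trans ?_ hh)
  rw [← Finset.sum_sub_distrib]
  refine Finset.sum_congr rfl fun σ hσ => ?_
  have hσ' : σ ∈ Y.conesOfDim 1 := Fan.mem_conesOfDim.2 (Fan.mem_above.1 hσ).1
  have hg := hv ⊥ Y.bot_mem (by rw [dim_bot]) σ hσ
  have := ite_heightIndex_eq L.exists_intCast_eq_diff hσ' hg
  rw [← mul_ite_zero, this, map_smul,
    linearPart_apply (hlin σ (Fan.mem_conesOfDim.1 hσ').1) hg.1, L.toFun_eq, smul_eq_mul]
  ring

/-- The map to the plane given by two tropical binomials. -/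
noncomputable def planeMap (L₁ L₂ : TropicalBinomial n) : (Fin n → ℝ) →ₗ[ℝ] ℝ × ℝ :=
  L₁.diff.prod L₂.diff

lemma isIntegralMap_planeMap (L₁ L₂ : TropicalBinomial n) : IsIntegralMap (planeMap L₁ L₂) := by
  intro x
  obtain ⟨d, hd⟩ := L₁.exists_intCast_eq_diff x
  obtain ⟨e, he⟩ := L₂.exists_intCast_eq_diff x
  exact ⟨d, e, by rw [hd, he]; rfl⟩

lemma det2_planeMap (L₁ L₂ : TropicalBinomial n) (x y : Fin n → ℝ) :
    det2 (planeMap L₁ L₂ x) (planeMap L₁ L₂ y) = L₁.diff x * L₂.diff y - L₂.diff x * L₁.diff y :=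
  rfl

open Classical in
-- Expanding the weights of `Y` gives a sum over pairs of a ray and a facet above it. A facet
-- contributes only when its first ray maps to the positive first axis. As `L₂` is linear on the
-- facet, that axis cannot enter its image strictly between the sides, so these are the facets
-- counted at (1, 0).
lemma IsFanProduct.fibreDegree_eq {L₁ L₂ : TropicalBinomial n} {X : TropicalFan n 2}
    {Y : TropicalFan n 1} (h : IsFanProduct L₂.toFun X Y) :
    Y.fibreDegree L₁.diff 1 (fun P => heightIndex L₁.diff P) =
      X.degree (planeMap L₁ L₂) (1, 0) := by
  obtain ⟨v, hv, hw⟩ := h.weight_eq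
  obtain ⟨hlin, hcones, -⟩ := h
  have hA := isIntegralMap_planeMap L₁ L₂
  have hfac : Y.facets = X.conesOfDim 1 := by
    ext τ
    rw [TropicalFan.mem_facets, Fan.mem_conesOfDim, hcones]
    constructor
    · exact fun h => ⟨h.1.1, h.2⟩
    · exact fun h => ⟨⟨h.1, h.2.le⟩, h.2⟩
  have h1 : Y.fibreDegree L₁.diff 1 (fun P => heightIndex L₁.diff P) =
      ∑ ρ ∈ X.conesOfDim 1, ∑ σ ∈ X.above 2 ρ,
        (X.weight σ : ℝ) * if L₂.diff (latticePt (rayGen ρ)) = 0 then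
          max 0 (L₁.diff (latticePt (rayGen ρ))) * max 0 (L₂.diff (latticePt (v ρ σ))) else 0 := by
    rw [TropicalFan.fibreDegree, hfac]
    refine Finset.sum_congr rfl fun ρ hρ => ?_
    rw [← mul_ite_zero, ite_heightIndex_eq L₁.exists_intCast_eq_diff hρ
      (Fan.isPrimitiveGenerator_rayGen hρ), hw ρ hρ]
    split_ifs
    · rw [Finset.sum_mul]
      exact Finset.sum_congr rfl fun σ _ => by ring
    · simp
  rw [h1, X.sum_rays_comm]
  refine Finset.sum_congr rfl fun σ hσ => ?_
  rw [← Finset.mul_sum]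
  congr 1
  by_cases htop : (linSpan σ).map (planeMap L₁ L₂) = ⊤
  · obtain ⟨ρ₁, ρ₂, h⟩ := exists_isRayPair X.toFan hσ htop
    have hm : (0 : ℝ) < areaIndex (planeMap L₁ L₂) (linSpan σ) := by
      exact_mod_cast h.areaIndex_pos hA
    have d₁ := h.det2_first hA (hv.isPrimitiveGenerator h.mem₁ hσ h.le₁)
    have d₂ := h.det2_second hA (hv.isPrimitiveGenerator h.mem₂ hσ h.le₂)
    have hpos := h.pos
    have hsgn := fun hp => TropicalBinomial.diff_nonneg_of_pos (hlin σ (Fan.mem_conesOfDim.1 hσ).1)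
      (h.le₂ (Fan.rayGen_mem h.mem₂)) (h.le₁ (Fan.rayGen_mem h.mem₁)) hp
    rw [h.sum_rays, h.inHalfOpen_iff]
    rw [det2_planeMap] at d₁ d₂ hpos
    have e₁ : det2 (planeMap L₁ L₂ (latticePt (rayGen ρ₁))) (1, 0) =
      -L₂.diff (latticePt (rayGen ρ₁)) := by simp [det2, planeMap]
    have e₂ : det2 (1, 0) (planeMap L₁ L₂ (latticePt (rayGen ρ₂))) =
      L₂.diff (latticePt (rayGen ρ₂)) := by simp [det2, planeMap]
    rw [e₁, e₂]
    generalize (areaIndex (planeMap L₁ L₂) (linSpan σ) : ℝ) = m at *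
    generalize L₁.diff (latticePt (rayGen ρ₁)) = a₁ at *
    generalize L₁.diff (latticePt (rayGen ρ₂)) = a₂ at *
    generalize L₂.diff (latticePt (rayGen ρ₁)) = b₁ at *
    generalize L₂.diff (latticePt (rayGen ρ₂)) = b₂ at *
    generalize L₂.diff (latticePt (v ρ₁ σ)) = c₁ at *
    generalize L₂.diff (latticePt (v ρ₂ σ)) = c₂ at *
    -- If the last ray maps to the positive axis, the facet lies below it, where max(0, `L₂.diff`)
    -- vanishes.
    have second : (if b₂ = 0 then max 0 a₂ * max 0 c₂ else 0) = 0 := by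
      split_ifs with hb
      · rw [hb, zero_mul, sub_zero] at d₂
        rcases le_or_gt a₂ 0 with ha | ha
        · rw [max_eq_left ha, zero_mul]
        · have : c₂ ≤ 0 := by nlinarith
          rw [max_eq_left this, mul_zero]
      · rfl
    rw [second, add_zero]
    by_cases hb : b₁ = 0
    · rw [if_pos hb]
      rw [hb, zero_mul, sub_zero] at d₁ hpos
      rcases le_or_gt a₁ 0 with ha | ha
      · have : ¬ 0 < b₂ := by intro hb2; nlinarith
        rw [max_eq_left ha, zero_mul, if_neg (fun h => this h.2)]
      · have hb2 : 0 < b₂ := by nlinarith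
        have hc1 : 0 < c₁ := by nlinarith
        rw [max_eq_right ha.le, max_eq_right hc1.le, if_pos ⟨by rw [hb, neg_zero], hb2⟩, d₁]
    · rw [if_neg hb, if_neg]
      rintro ⟨h1, h2⟩
      exact hb (le_antisymm (by linarith) (hsgn h2))
  · rw [areaIndex_eq_zero htop, Finset.sum_eq_zero]
    · simp
    · intro ρ hρ
      obtain ⟨hρ, hle⟩ := Finset.mem_filter.1 hρ
      have := det2_eq_zero_of_map_ne_top htop (mem_linSpan (hle (Fan.rayGen_mem hρ)))
        (mem_linSpan (hv.isPrimitiveGenerator hρ hσ hle).1)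
      rw [det2_planeMap] at this
      split_ifs with hb
      · rw [hb, zero_mul, sub_zero] at this
        rcases mul_eq_zero.1 this with h | h <;> simp [h]
      · rfl

lemma IntersectionNumberEq.degree_eq {L₁ L₂ : TropicalBinomial n} {X : TropicalFan n 2} {m : ℕ}
    (h : IntersectionNumberEq L₁.toFun L₂.toFun X m) {q : ℝ × ℝ} (hq : q ≠ 0) :
    X.degree (planeMap L₁ L₂) q = m := by
  obtain ⟨Y, Z, ⟨X', Y', hX, hXY, hY⟩, ⟨Y'', Z', hY', hYZ, hZ⟩, hm⟩ := h
  have hk : Module.finrank ℝ ℝ = 1 := Module.finrank_self ℝ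
  rw [hX.degree_eq (q' := (1, 0)) (isIntegralMap_planeMap L₁ L₂) hq (by simp),
    ← hXY.fibreDegree_eq,
    hY.fibreDegree_eq_of_le_one hk le_rfl (fun _ => one_ne_zero),
    hY'.fibreDegree_eq_of_le_one hk le_rfl (fun _ => one_ne_zero), ← hYZ.weight_bot_eq,
    hZ.weight_bot_eq, hm]

end TropicalGallery

namespace TropicalGallery

variable {n : ℕ}

/-! ### Galleries of degree one -/

/-- Since V(L₁) ∩ V(L₂) is the kernel, the dimension condition says that kernel and ⟨σ⟩ span
everything; surjectivity turns this into ⟨σ⟩ mapping onto the plane. -/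
lemma mem_gallery_iff {F : TropicalFan n 2} {L₁ L₂ : TropicalBinomial n}
    (hsurj : LinearMap.range (planeMap L₁ L₂) = ⊤) {σ : Cone n} :
    σ ∈ gallery F L₁ L₂ ↔ σ ∈ F.conesOfDim 2 ∧ (linSpan σ).map (planeMap L₁ L₂) = ⊤ := by
  have hker : L₁.hypersurface ⊓ L₂.hypersurface = LinearMap.ker (planeMap L₁ L₂) :=
    (LinearMap.ker_prod L₁.diff L₂.diff).symm
  have hfin : Module.finrank ℝ ↥((L₁.hypersurface ⊓ L₂.hypersurface) ⊔ linSpan σ) = n ↔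
      (linSpan σ).map (planeMap L₁ L₂) = ⊤ := by
    rw [hker]
    constructor
    · intro h
      have htop := Submodule.eq_top_of_finrank_eq (h.trans (Module.finrank_fin_fun ℝ).symm)
      have := congrArg (Submodule.map (planeMap L₁ L₂)) htop
      rwa [Submodule.map_sup, Submodule.map_top, hsurj,
        LinearMap.le_ker_iff_map.1 le_rfl, bot_sup_eq] at this
    · intro h
      have := Submodule.comap_map_eq (planeMap L₁ L₂) (linSpan σ)
      rw [h, Submodule.comap_top] at this
      rw [sup_comm, ← this, finrank_top, Module.finrank_fin_fun]
  exact and_congr Iff.rfl hfin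

namespace TropicalFan

variable {F : TropicalFan n 2} {A : (Fin n → ℝ) →ₗ[ℝ] ℝ × ℝ}

lemma exists_map_eq_top_of_degree_ne_zero {q : ℝ × ℝ} (h : F.degree A q ≠ 0) :
    ∃ σ ∈ F.conesOfDim 2, (linSpan σ).map A = ⊤ := by
  classical
  by_contra! hcon
  refine h (Finset.sum_eq_zero fun σ hσ => ?_)
  simp [areaIndex_eq_zero (hcon σ hσ)]

lemma one_le_weight_mul {σ ρ₁ ρ₂ : Cone n} (hA : IsIntegralMap A)
    (h : IsRayPair F.toFan A σ ρ₁ ρ₂) (hw : F.weight σ ≠ 0) :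
    (1 : ℝ) ≤ (F.weight σ : ℝ) * areaIndex A (linSpan σ) := by
  have h1 := Nat.mul_pos (Nat.pos_of_ne_zero hw) (h.areaIndex_pos hA)
  exact_mod_cast h1

/-- If the degree is `1`, no direction lies in two half-open images. -/
lemma eq_of_inHalfOpen (hA : IsIntegralMap A) {q : ℝ × ℝ} (hdeg : F.degree A q = 1)
    {σ σ' ρ₁ ρ₂ ρ₁' ρ₂' : Cone n} (h : IsRayPair F.toFan A σ ρ₁ ρ₂)
    (h' : IsRayPair F.toFan A σ' ρ₁' ρ₂') (hw : F.weight σ ≠ 0) (hw' : F.weight σ' ≠ 0)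
    (hq : InHalfOpen A σ q) (hq' : InHalfOpen A σ' q) : σ = σ' := by
  classical
  by_contra hne
  have hle := Finset.sum_le_sum_of_subset_of_nonneg
    (s := {σ, σ'}) (t := F.conesOfDim 2)
    (f := fun τ => (F.weight τ : ℝ) * if InHalfOpen A τ q then (areaIndex A (linSpan τ) : ℝ) else 0)
    (by
      intro τ hτ
      rcases Finset.mem_insert.1 hτ with rfl | hτ
      · exact h.mem
      · rw [Finset.mem_singleton.1 hτ]; exact h'.mem)
    (fun τ _ _ => by positivity)
  rw [Finset.sum_pair hne, if_pos hq, if_pos hq'] at hle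
  have h1 := one_le_weight_mul hA h hw
  have h2 := one_le_weight_mul hA h' hw'
  have h3 := hle.trans hdeg.le
  linarith

end TropicalFan

lemma IsRayPair.inHalfOpen_first {X : Fan n} {A : (Fin n → ℝ) →ₗ[ℝ] ℝ × ℝ} {σ ρ₁ ρ₂ : Cone n}
    (h : IsRayPair X A σ ρ₁ ρ₂) : InHalfOpen A σ (A (latticePt (rayGen ρ₁))) :=
  (h.inHalfOpen_iff _).2 ⟨by simp, h.pos⟩

lemma IsRayPair.first_ne_zero {X : Fan n} {A : (Fin n → ℝ) →ₗ[ℝ] ℝ × ℝ} {σ ρ₁ ρ₂ : Cone n}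
    (h : IsRayPair X A σ ρ₁ ρ₂) : A (latticePt (rayGen ρ₁)) ≠ 0 := fun h0 => by
  have := h.pos
  simp [h0] at this

lemma Fan.ray_le_of_rayGen_mem (X : Fan n) {ρ σ : Cone n} (hρ : ρ ∈ X.conesOfDim 1)
    (hσ : σ ∈ X.cones) (h : latticePt (rayGen ρ) ∈ σ) : ρ ≤ σ := by
  obtain ⟨hρX, hd⟩ := Fan.mem_conesOfDim.1 hρ
  have hmem : latticePt (rayGen ρ) ∈ ρ ⊓ σ := ⟨Fan.rayGen_mem hρ, h⟩
  have hdim : dim (ρ ⊓ σ) ≠ 0 := fun h0 =>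
    Fan.rayGen_ne_zero hρ (eq_zero_of_dim_eq_zero h0 hmem)
  exact inf_eq_left.1 (eq_of_face_of_dim_le (X.inter_face ρ hρX σ hσ).1 (by omega))

/-- A finite set of facets of a tropical fan of degree `1` over the plane, containing exactly the
facets which `A` maps onto a cone of dimension `2`; each facet `σ` of the set has the rays
`first σ` and `last σ`. -/
structure IsDegreeOneGallery (F : TropicalFan n 2) (A : (Fin n → ℝ) →ₗ[ℝ] ℝ × ℝ)
    (G : Finset (Cone n)) (first last : Cone n → Cone n) : Prop where
  integral : IsIntegralMap A
  degree_eq : ∀ q, q ≠ 0 → F.degree A q = 1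
  mem_iff : ∀ σ, σ ∈ G ↔ σ ∈ F.conesOfDim 2 ∧ (linSpan σ).map A = ⊤
  weight_ne : ∀ σ ∈ G, F.weight σ ≠ 0
  isRayPair : ∀ σ ∈ G, IsRayPair F.toFan A σ (first σ) (last σ)

namespace IsDegreeOneGallery

variable {F : TropicalFan n 2} {A : (Fin n → ℝ) →ₗ[ℝ] ℝ × ℝ} {G : Finset (Cone n)}
  {first last : Cone n → Cone n}

/-- Both half-open images contain the direction of the common first ray. -/
lemma first_injOn (h : IsDegreeOneGallery F A G first last) {σ σ' : Cone n} (hσ : σ ∈ G)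
    (hσ' : σ' ∈ G) (heq : first σ = first σ') : σ = σ' := by
  have p := h.isRayPair σ hσ
  have p' := h.isRayPair σ' hσ'
  exact TropicalFan.eq_of_inHalfOpen h.integral (h.degree_eq _ p.first_ne_zero) p p'
    (h.weight_ne σ hσ) (h.weight_ne σ' hσ') p.inHalfOpen_first (heq ▸ p'.inHalfOpen_first)

/-- The contribution of a facet to the balancing condition, projected to the plane. -/
lemma sign_cases (h : IsDegreeOneGallery F A G first last) {v : Cone n → Cone n → Fin n → ℤ}
    (hv : IsNormalSystem F.toFan 2 v) {ρ σ : Cone n} (hρ : ρ ∈ F.conesOfDim 1)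
    (hσ : σ ∈ F.above 2 ρ) :
    (σ ∈ G ∧ ρ = first σ ∧
      0 < (F.weight σ : ℝ) * det2 (A (latticePt (rayGen ρ))) (A (latticePt (v ρ σ)))) ∨
    (σ ∈ G ∧ ρ = last σ ∧
      (F.weight σ : ℝ) * det2 (A (latticePt (rayGen ρ))) (A (latticePt (v ρ σ))) < 0) ∨
    (σ ∉ G ∧ det2 (A (latticePt (rayGen ρ))) (A (latticePt (v ρ σ))) = 0) := by
  obtain ⟨hσ2, hle⟩ := Fan.mem_above.1 hσ
  replace hσ2 := Fan.mem_conesOfDim.2 hσ2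
  have hprim := hv.isPrimitiveGenerator hρ hσ2 hle
  by_cases hG : σ ∈ G
  · have p := h.isRayPair σ hG
    have h1 := TropicalFan.one_le_weight_mul h.integral p (h.weight_ne σ hG)
    rcases p.eq_or_eq hρ hle with rfl | rfl
    · left
      rw [p.det2_first h.integral hprim]
      exact ⟨hG, rfl, by linarith⟩
    · right; left
      rw [p.det2_second h.integral hprim]
      exact ⟨hG, rfl, by linarith⟩
  · right; right
    refine ⟨hG, det2_eq_zero_of_map_ne_top (fun htop => hG ((h.mem_iff σ).2 ⟨hσ2, htop⟩))
      (mem_linSpan (hle (Fan.rayGen_mem hρ))) (mem_linSpan hprim.1)⟩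

/-- At its first ray `σ` contributes a positive term to a vanishing sum; only a facet ending at that
ray can compensate it. -/
lemma exists_last_eq_first (h : IsDegreeOneGallery F A G first last) {σ : Cone n} (hσ : σ ∈ G) :
    ∃ σ' ∈ G, last σ' = first σ := by
  obtain ⟨v, hv, -⟩ := F.balanced
  have p := h.isRayPair σ hσ
  by_contra! hcon
  have hsum := F.sum_above_eq_zero A hv p.mem₁
  refine (Finset.sum_pos' (fun τ hτ => ?_) ⟨σ, Fan.mem_above.2
    ⟨Fan.mem_conesOfDim.1 p.mem, p.le₁⟩, ?_⟩).ne' hsum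
  · rcases h.sign_cases hv p.mem₁ hτ with h1 | ⟨h1, h2, -⟩ | h1
    · exact h1.2.2.le
    · exact absurd h2.symm (hcon τ h1)
    · rw [h1.2, mul_zero]
  · rcases h.sign_cases hv p.mem₁ (Fan.mem_above.2
      ⟨Fan.mem_conesOfDim.1 p.mem, p.le₁⟩) with h1 | ⟨h1, h2, -⟩ | h1
    · exact h1.2.2
    · exact absurd h2.symm (hcon σ h1)
    · exact absurd hσ h1.1

lemma exists_first_eq_last (h : IsDegreeOneGallery F A G first last) {σ : Cone n} (hσ : σ ∈ G) :
    ∃ σ' ∈ G, first σ' = last σ := by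
  obtain ⟨v, hv, -⟩ := F.balanced
  have p := h.isRayPair σ hσ
  by_contra! hcon
  have hsum := F.sum_above_eq_zero A hv p.mem₂
  refine (Finset.sum_neg' (fun τ hτ => ?_) ⟨σ, Fan.mem_above.2
    ⟨Fan.mem_conesOfDim.1 p.mem, p.le₂⟩, ?_⟩).ne hsum
  · rcases h.sign_cases hv p.mem₂ hτ with ⟨h1, h2, -⟩ | h1 | h1
    · exact absurd h2.symm (hcon τ h1)
    · exact h1.2.2.le
    · rw [h1.2, mul_zero]
  · rcases h.sign_cases hv p.mem₂ (Fan.mem_above.2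
      ⟨Fan.mem_conesOfDim.1 p.mem, p.le₂⟩) with ⟨h1, h2, -⟩ | h1 | h1
    · exact absurd h2.symm (hcon σ h1)
    · exact h1.2.2
    · exact absurd hσ h1.1

/-- The half-open convention treats the sides unequally, so this comes by counting: `first` and
`last` have the same image on the finite set `G`, and `first` is injective. -/
lemma last_injOn (h : IsDegreeOneGallery F A G first last) {σ σ' : Cone n} (hσ : σ ∈ G)
    (hσ' : σ' ∈ G) (heq : last σ = last σ') : σ = σ' := by
  classical
  have himage : G.image last = G.image first := by
    refine Finset.Subset.antisymm (fun ρ hρ => ?_) (fun ρ hρ => ?_)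
    · obtain ⟨τ, hτ, rfl⟩ := Finset.mem_image.1 hρ
      obtain ⟨τ', hτ', h'⟩ := h.exists_first_eq_last hτ
      exact Finset.mem_image.2 ⟨τ', hτ', h'⟩
    · obtain ⟨τ, hτ, rfl⟩ := Finset.mem_image.1 hρ
      obtain ⟨τ', hτ', h'⟩ := h.exists_last_eq_first hτ
      exact Finset.mem_image.2 ⟨τ', hτ', h'⟩
  have hcard : (G.image last).card = G.card := by
    rw [himage]
    exact Finset.card_image_of_injOn fun τ hτ τ' hτ' => h.first_injOn hτ hτ'
  exact Finset.card_image_iff.1 hcard hσ hσ' heq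

/-- Exactly two facets of the gallery contain a given ray of a facet of the gallery. -/
lemma exists_pair (h : IsDegreeOneGallery F A G first last) {σ ρ : Cone n} (hσ : σ ∈ G)
    (hρ : ρ ∈ F.conesOfDim 1) (hle : ρ ≤ σ) :
    ∃ σ₁ ∈ G, ∃ σ₂ ∈ G, σ₁ ≠ σ₂ ∧ first σ₁ = ρ ∧ last σ₂ = ρ ∧
      ∀ τ ∈ G, ρ ≤ τ → τ = σ₁ ∨ τ = σ₂ := by
  obtain ⟨σ₁, h₁, σ₂, h₂, e₁, e₂⟩ : ∃ σ₁ ∈ G, ∃ σ₂ ∈ G, first σ₁ = ρ ∧ last σ₂ = ρ := by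
    rcases (h.isRayPair σ hσ).eq_or_eq hρ hle with rfl | rfl
    · obtain ⟨σ', hσ', e⟩ := h.exists_last_eq_first hσ
      exact ⟨σ, hσ, σ', hσ', rfl, e⟩
    · obtain ⟨σ', hσ', e⟩ := h.exists_first_eq_last hσ
      exact ⟨σ', hσ', σ, hσ, e, rfl⟩
  refine ⟨σ₁, h₁, σ₂, h₂, ?_, e₁, e₂, fun τ hτ hρτ => ?_⟩
  · rintro rfl
    exact (h.isRayPair σ₁ h₁).ne (e₁.trans e₂.symm)
  · rcases (h.isRayPair τ hτ).eq_or_eq hρ hρτ with e | e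
    · exact Or.inl (h.first_injOn hτ h₁ (e.symm.trans e₁.symm))
    · exact Or.inr (h.last_injOn hτ h₂ (e.symm.trans e₂.symm))

/-- A subset of the gallery which contains with a facet all its neighbours is everything. -/
lemma mem_of_adjacency_closed (h : IsDegreeOneGallery F A G first last) {C : Set (Cone n)}
    (hC : C ⊆ G) (hne : C.Nonempty) (hclosed : ∀ σ ∈ C, ∀ τ ∈ G, ∀ ρ ∈ F.conesOfDim 1,
      ρ ≤ σ → ρ ≤ τ → τ ∈ C) {τ : Cone n} (hτ : τ ∈ G) : τ ∈ C := by
  classical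
  obtain ⟨v, hv, -⟩ := F.balanced
  set w : Cone n → ℝ := fun κ => if κ ∈ C then (F.weight κ : ℝ) else 0 with hw
  have hbal : ∀ ρ ∈ F.conesOfDim 1, ∑ κ ∈ F.above 2 ρ,
      w κ * det2 (A (latticePt (rayGen ρ))) (A (latticePt (v ρ κ))) = 0 := by
    intro ρ hρ
    -- At a ray touching `C` all gallery facets belong to `C` and the other facets have determinant
    -- zero, so the full sum is unchanged; at other rays every term vanishes.
    by_cases hex : ∃ κ ∈ C, ρ ≤ κ
    · obtain ⟨κ₀, hκ₀, hle₀⟩ := hex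
      rw [← F.sum_above_eq_zero A hv hρ]
      refine Finset.sum_congr rfl fun κ hκ => ?_
      rcases em (κ ∈ G) with hG | hG
      · simp only [hw, if_pos (hclosed κ₀ hκ₀ κ hG ρ hρ hle₀ (Fan.mem_above.1 hκ).2)]
      · rcases h.sign_cases hv hρ hκ with h1 | h1 | h1
        · exact absurd h1.1 hG
        · exact absurd h1.1 hG
        · rw [h1.2, mul_zero, mul_zero]
    · push Not at hex
      refine Finset.sum_eq_zero fun κ hκ => ?_
      have : κ ∉ C := fun hκC => hex κ hκC (Fan.mem_above.1 hκ).2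
      simp only [hw, if_neg this, zero_mul]
  obtain ⟨σ, hσ⟩ := hne
  have p := h.isRayPair σ (hC hσ)
  have p' := h.isRayPair τ hτ
  have hconst := halfOpenDegree_eq h.integral hv hbal p.first_ne_zero p'.first_ne_zero
  have hpos : halfOpenDegree F.toFan A w (A (latticePt (rayGen (first σ)))) ≠ 0 := by
    refine (Finset.sum_pos' (fun κ _ => ?_) ⟨σ, p.mem, ?_⟩).ne'
    · simp only [hw]; positivity
    · rw [if_pos p.inHalfOpen_first]
      simp only [hw, if_pos hσ]
      linarith [TropicalFan.one_le_weight_mul h.integral p (h.weight_ne σ (hC hσ))]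
  rw [hconst] at hpos
  obtain ⟨κ, -, hκ⟩ := Finset.exists_ne_zero_of_sum_ne_zero hpos
  have hκC : κ ∈ C := by
    by_contra hcon
    simp [hw, hcon] at hκ
  have hκq : InHalfOpen A κ (A (latticePt (rayGen (first τ)))) := by
    by_contra hcon
    simp [hcon] at hκ
  have := TropicalFan.eq_of_inHalfOpen h.integral (h.degree_eq _ p'.first_ne_zero)
    (h.isRayPair κ (hC hκC)) p' (h.weight_ne κ (hC hκC)) (h.weight_ne τ hτ) hκq p'.inHalfOpen_first
  exact this ▸ hκC

end IsDegreeOneGallery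

lemma exists_isDegreeOneGallery {F : TropicalFan n 2} {L₁ L₂ : TropicalBinomial n}
    (hreg : IntersectionNumberEq L₁.toFun L₂.toFun F 1)
    (hweight : ∀ σ ∈ gallery F L₁ L₂, F.weight σ ≠ 0) :
    ∃ G first last, IsDegreeOneGallery F (planeMap L₁ L₂) G first last ∧
      ∀ σ, σ ∈ G ↔ σ ∈ gallery F L₁ L₂ := by
  classical
  have hdeg : ∀ q, q ≠ 0 → F.degree (planeMap L₁ L₂) q = 1 := fun q hq => by
    rw [hreg.degree_eq hq, Nat.cast_one]
  -- A nonzero degree forces some facet to span the plane after projection.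
  have hsurj : LinearMap.range (planeMap L₁ L₂) = ⊤ := by
    have h1 := hdeg (1, 0) (by simp)
    obtain ⟨σ, -, hσ⟩ := TropicalFan.exists_map_eq_top_of_degree_ne_zero
      (F := F) (A := planeMap L₁ L₂) (q := (1, 0)) (by rw [h1]; exact one_ne_zero)
    rw [eq_top_iff, ← hσ]
    exact LinearMap.map_le_range
  have hmem : ∀ σ, σ ∈ (F.conesOfDim 2).filter (fun σ => (linSpan σ).map (planeMap L₁ L₂) = ⊤) ↔
      σ ∈ gallery F L₁ L₂ := fun σ => by rw [mem_gallery_iff hsurj, Finset.mem_filter]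
  have hex : ∀ σ : Cone n, ∃ ρ₁ ρ₂,
      σ ∈ gallery F L₁ L₂ → IsRayPair F.toFan (planeMap L₁ L₂) σ ρ₁ ρ₂ := by
    intro σ
    by_cases hσ : σ ∈ gallery F L₁ L₂
    · obtain ⟨h1, h2⟩ := (mem_gallery_iff hsurj).1 hσ
      obtain ⟨ρ₁, ρ₂, h⟩ := exists_isRayPair F.toFan h1 h2
      exact ⟨ρ₁, ρ₂, fun _ => h⟩
    · exact ⟨σ, σ, fun h => absurd h hσ⟩
  choose first last hpair using hex
  exact ⟨_, first, last, ⟨isIntegralMap_planeMap L₁ L₂, hdeg, fun σ => Finset.mem_filter,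
    fun σ hσ => hweight σ ((hmem σ).1 hσ), fun σ hσ => hpair σ ((hmem σ).1 hσ)⟩, hmem⟩

end TropicalGallery

/-! ### The gallery as a cycle -/

open TropicalGallery in
theorem proposition4p10 {n : ℕ} (F : TropicalFan n 2) (L₁ L₂ : TropicalBinomial n)
    (hreg : IntersectionNumberEq L₁.toFun L₂.toFun F 1)
    (hweight : ∀ σ ∈ gallery F L₁ L₂, F.weight σ ≠ 0)
    (hne : (gallery F L₁ L₂).Nonempty) :
    (∀ ρ ∈ F.conesOfDim 1, (ρ : Set (Fin n → ℝ)) ⊆ gallerySupport F L₁ L₂ →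
      (ad F ρ ∩ gallery F L₁ L₂).ncard = 2) ∧
    ((galleryGraph F L₁ L₂).Connected ∧
      ∀ σ, ((galleryGraph F L₁ L₂).neighborSet σ).ncard = 2) := by
  obtain ⟨G, first, last, h, hG⟩ := exists_isDegreeOneGallery hreg hweight
  refine ⟨fun ρ hρ hsub => ?_, ?_, fun σ => ?_⟩
  · obtain ⟨σ, hσ, hmem⟩ := hsub (Fan.rayGen_mem hρ)
    have hle := F.ray_le_of_rayGen_mem hρ (Fan.mem_conesOfDim.1 hσ.1).1 hmem
    obtain ⟨σ₁, h₁, σ₂, h₂, hne, e₁, e₂, hall⟩ := h.exists_pair ((hG σ).2 hσ) hρ hle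
    have : ad F ρ ∩ gallery F L₁ L₂ = {σ₁, σ₂} := by
      ext τ
      constructor
      · rintro ⟨⟨-, hρτ⟩, hτ⟩
        exact hall τ ((hG τ).2 hτ) hρτ
      · rintro (rfl | rfl)
        · exact ⟨⟨((hG _).1 h₁).1, e₁ ▸ (h.isRayPair _ h₁).le₁⟩, (hG _).1 h₁⟩
        · exact ⟨⟨((hG _).1 h₂).1, e₂ ▸ (h.isRayPair _ h₂).le₂⟩, (hG _).1 h₂⟩
    rw [this, Set.ncard_pair hne]
  · have : Nonempty (gallery F L₁ L₂) := hne.to_subtype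
    refine ⟨fun σ τ => ?_⟩
    have := h.mem_of_adjacency_closed
      (C := {κ | ∃ hκ : κ ∈ gallery F L₁ L₂, (galleryGraph F L₁ L₂).Reachable σ ⟨κ, hκ⟩})
      (fun κ hκ => (hG κ).2 hκ.1) ⟨σ, σ.2, SimpleGraph.Reachable.refl _⟩ ?_ ((hG τ).2 τ.2)
    · exact this.2
    · rintro κ ⟨hκ, hr⟩ κ' hκ' ρ hρ hle hle'
      refine ⟨(hG κ').1 hκ', ?_⟩
      by_cases heq : κ = κ'
      · subst heq; exact hr
      · refine hr.trans (SimpleGraph.Adj.reachable ?_)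
        exact ⟨fun h => heq (congrArg Subtype.val h), ρ, hρ, hle, hle'⟩
  · obtain ⟨σ, hσ⟩ := σ
    have hσG := (hG σ).2 hσ
    have p := h.isRayPair σ hσG
    obtain ⟨α, hα, eα⟩ := h.exists_last_eq_first hσG
    obtain ⟨β, hβ, eβ⟩ := h.exists_first_eq_last hσG
    have pα := h.isRayPair α hα
    have pβ := h.isRayPair β hβ
    have hασ : α ≠ σ := by rintro rfl; exact pα.ne eα.symm
    have hβσ : β ≠ σ := by rintro rfl; exact pβ.ne eβ
    -- A single facet on both sides would have the rays of `σ` in reversed order, contradicting the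
    -- orientation.
    have hαβ : α ≠ β := by
      rintro rfl
      have h1 := pα.pos
      have h2 := p.pos
      rw [eα, eβ, det2_swap] at h1
      linarith
    have : (galleryGraph F L₁ L₂).neighborSet ⟨σ, hσ⟩ =
        {⟨α, (hG α).1 hα⟩, ⟨β, (hG β).1 hβ⟩} := by
      ext ⟨τ, hτ⟩
      rw [SimpleGraph.mem_neighborSet, Set.mem_insert_iff, Set.mem_singleton_iff, Subtype.mk.injEq,
        Subtype.mk.injEq]
      have hτG := (hG τ).2 hτ
      constructor
      · rintro ⟨hne, ρ, hρ, hle, hle'⟩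
        replace hne : σ ≠ τ := fun h => hne (Subtype.ext h)
        -- Sharing a ray in the same role gives equality, so neighbours share it in opposite roles:
        -- they are α and β.
        rcases p.eq_or_eq hρ hle with rfl | rfl <;>
          rcases (h.isRayPair τ hτG).eq_or_eq hρ hle' with e | e
        · exact absurd (h.first_injOn hσG hτG e) hne
        · exact Or.inl (h.last_injOn hτG hα (e.symm.trans eα.symm))
        · exact Or.inr (h.first_injOn hτG hβ (e.symm.trans eβ.symm))
        · exact absurd (h.last_injOn hσG hτG e) hne
      · rintro (rfl | rfl)
        · exact ⟨fun h => hασ (congrArg Subtype.val h).symm, first σ, p.mem₁, p.le₁, eα ▸ pα.le₂⟩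
        · exact ⟨fun h => hβσ (congrArg Subtype.val h).symm, last σ, p.mem₂, p.le₂, eβ ▸ pβ.le₁⟩
    rw [this, Set.ncard_pair (by simpa using hαβ)]
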